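/- A tree is a partially ordered set $(V;\le)$ with a least element such that for every $x\in V$ the set $\{y\mid y\le x\}$ is finite and linearly ordered by $\le$. The level of $x$ is $|\{y\mid y<x\}|$, and the height of the tree is the supremum of the levels of its nodes. A recursive presentation of a tree is a pair of programs (Turing machines), halting on all inputs, that decide a set $D\subseteq\mathbb N$ and a relation $R\subseteq D\times D$ such that $(D;R)$ is a tree. For $n\in\mathbb N$, the isomorphism problem for recursive trees of height at most $n$ is the set of all pairs $(P_1,P_2)$ of recursive presentations of trees of height at most $n$ such that the trees presented by $P_1$ and $P_2$ are isomorphic. **Theorem.** For every $n\ge 1$, the isomorphism problem for recursive trees of height at most $n$ is $\Pi^0_{2n}$-complete; that is, it belongs to $\Pi^0_{2n}$ (as a set of pairs of pairs of programs), and every $\Pi^0_{2n}$ set of natural numbers is many-one reducible to it. Hardness does not come from recognizing valid presentations: for every $\Pi^0_{2n}$ set $B\subseteq\mathbb N$ there is a computable function $x\mapsto(P_1(x),P_2(x))$ such that, for every $x\in\mathbb N$, both $P_1(x)$ and $P_2(x)$ are recursive presentations of trees of height at most $n$, and $x\in B$ if and only if the trees presented by $P_1(x)$ and $P_2(x)$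 are isomorphic. -/

import Mathlib

open Nat.Partrec (Code)

namespace RecTree

/-! ## The arithmetical hierarchy -/

/-- `IsSigma0 k p`: the predicate `p` is in the class `Σ⁰_k`. The class `Σ⁰_0` consists of the
decidable predicates, and `p` is in `Σ⁰_{k+1}` iff `p a ↔ ∃ y, ¬ q (a, y)` for some `q` in `Σ⁰_k`,
that is, iff `p` is a projection of the complement of a `Σ⁰_k` predicate. -/
def IsSigma0 : ℕ → ∀ {α : Type} [Primcodable α], (α → Prop) → Prop
  | 0, _, _, p => ComputablePred p
  | k + 1, α, _, p => ∃ q : α × ℕ → Prop, IsSigma0 k q ∧ ∀ a, p a ↔ ∃ y, ¬ q (a, y)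

/-- `IsPi0 k p`: the complement of `p` is in `Σ⁰_k`. -/
def IsPi0 (k : ℕ) {α : Type} [Primcodable α] (p : α → Prop) : Prop :=
  IsSigma0 k fun a => ¬ p a

/-- `p` is `Π⁰_k`-complete: it is in `Π⁰_k`, and every `Π⁰_k` set of natural numbers is
many-one reducible to `p`. -/
def IsPi0Complete (k : ℕ) {α : Type} [Primcodable α] (p : α → Prop) : Prop :=
  IsPi0 k p ∧ ∀ B : ℕ → Prop, IsPi0 k B → ManyOneReducible B p

/-! ## Trees -/

/-- `(V; le)` is a tree: a partial order with a least element such that the elements below any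
given element form a finite linear order. -/
structure IsTree {V : Type} (le : V → V → Prop) : Prop where
  refl : ∀ x, le x x
  antisymm : ∀ x y, le x y → le y x → x = y
  trans : ∀ x y z, le x y → le y z → le x z
  exists_root : ∃ r, ∀ x, le r x
  finite_ancestors : ∀ x, {y | le y x}.Finite
  linear_ancestors : ∀ x y z, le y x → le z x → le y z ∨ le z y

/-- The level of `x`: the number of elements strictly below `x`. -/
noncomputable def level {V : Type} (le : V → V → Prop) (x : V) : ℕ∞ :=
  {y | le y x ∧ y ≠ x}.encard

/-- The height: the supremum of the levels. -/
noncomputable def height {V : Type} (le : V → V → Prop) : ℕ∞ :=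
  ⨆ x, level le x

/-! ## Recursive presentations -/

/-- The program `c` accepts the input `x`: it halts with output `1`. -/
def Accepts (c : Code) (x : ℕ) : Prop := c.eval x = Part.some 1

/-- The program `c` rejects the input `x`: it halts with output `0`. -/
def Rejects (c : Code) (x : ℕ) : Prop := c.eval x = Part.some 0

/-- The program `c` is a decision procedure: it accepts or rejects every input. -/
def IsDecider (c : Code) : Prop := ∀ x, Accepts c x ∨ Rejects c x

/-- A pair of programs, meant to decide the domain and the binary relation of a structure
`(D; R)` with `D ⊆ ℕ`, where pairs of naturals are coded by `Nat.pair`. -/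
abbrev Presentation := Code × Code

namespace Presentation

/-- The domain of the structure `S(P)`. -/
def Dom (P : Presentation) : Type := {x : ℕ // Accepts P.1 x}

/-- The binary relation of the structure `S(P)`. -/
def rel (P : Presentation) (a b : P.Dom) : Prop := Accepts P.2 (Nat.pair a.1 b.1)

/-- `P` really is a recursive presentation: its two programs decide a set `D ⊆ ℕ` and
a relation `R ⊆ D × D`. -/
structure IsValid (P : Presentation) : Prop where
  decides_dom : IsDecider P.1
  decides_rel : IsDecider P.2
  rel_subset : ∀ a b, Accepts P.2 (Nat.pair a b) → Accepts P.1 a ∧ Accepts P.1 b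

/-- `P` is a recursive presentation of a tree of height at most `n`. -/
def IsTreeOfHeightLE (n : ℕ) (P : Presentation) : Prop :=
  P.IsValid ∧ IsTree P.rel ∧ height P.rel ≤ n

/-- The structures presented by `P` and `Q` are isomorphic. -/
def Iso (P Q : Presentation) : Prop := Nonempty (P.rel ≃r Q.rel)

end Presentation

/-- The isomorphism problem for recursive trees of height at most `n`: the set of all pairs of
recursive presentations of isomorphic trees of height at most `n`. -/
def IsoProblem (n : ℕ) (p : Presentation × Presentation) : Prop :=
  p.1.IsTreeOfHeightLE n ∧ p.2.IsTreeOfHeightLE n ∧ p.1.Iso p.2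

end RecTree

namespace RecTree

/-! ## Closure properties of the arithmetical hierarchy -/

section Hierarchy

variable {α β : Type} [Primcodable α] [Primcodable β]

/-! Upper bound. In a countable tree, the subtree above a node is determined up to isomorphism by
how many children carry each isomorphism type. Two such counts agree as soon as every finite family
of distinct children on either side can be matched with distinct children of the same types on the
other side (`coneIso_iff_lists`). A finite family is a single list, so each level of the tree costs
one ∀∃ block and leaves cost nothing: height `n` gives `Π⁰_{2n}` (`ArithIso`, `isPi0_arithIso`).
Recognizing presentations of trees of height at most `n` is only `Π⁰_2` (`isPi0_arithTree`).

Hardness. A `Π⁰_{2n}` predicate amounts to `n` nested quantifiers "infinitely many" in front of a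
decidable `R` (`IsPi0.exists_infinite`, `IsPi0.exists_infQuant`). The tree coding `R` has below its
root the trees coding the sections of `R`, padded with infinitely many trees of every possible
finite invariant. The padding leaves visible only the number of sections satisfying the remaining
quantifiers; this number, `infCount`, determines the isomorphism type
(`nonempty_relIso_of_infCount_eq`). It is infinite exactly when the nested quantifiers hold, and
then the tree is isomorphic to the one coding the true predicate. Conversely, how deep the root
branches infinitely is an isomorphism invariant from which the quantifiers are read off
(`branching_nodeLE_iff`). -/

theorem computablePred_of_bool {p : α → Prop} (f : α → Bool) (hf : Computable f)
    (h : ∀ a, p a ↔ f a = true) : ComputablePred p :=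
  ComputablePred.computable_iff.2 ⟨f, hf, funext fun a => propext (h a)⟩

theorem _root_.ComputablePred.comp' {p : α → Prop} (hp : ComputablePred p) {f : β → α}
    (hf : Computable f) : ComputablePred fun b => p (f b) := by
  classical
  exact (hp.decide.comp hf).computablePred

theorem _root_.ComputablePred.and' {p q : α → Prop} (hp : ComputablePred p) (hq : ComputablePred q) :
    ComputablePred fun a => p a ∧ q a := by
  classical
  exact computablePred_of_bool (fun a => decide (p a) && decide (q a))
    (Primrec.and.to_comp.comp hp.decide hq.decide) (by simp)

theorem _root_.ComputablePred.forall_lt' {p : α × ℕ → Prop} (hp : ComputablePred p) :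
    ComputablePred fun x : α × ℕ => ∀ i < x.2, p (x.1, i) := by
  classical
  refine computablePred_of_bool
    (fun x : α × ℕ => Nat.rec true (fun y b => decide (p (x.1, y)) && b) x.2) ?_ ?_
  · refine Computable.nat_rec (h := fun x (yb : ℕ × Bool) => decide (p (x.1, yb.1)) && yb.2)
      Computable.snd (Computable.const true) ?_
    exact Primrec.and.to_comp.comp
      (hp.decide.comp (Computable.pair (Computable.fst.comp Computable.fst)
        (Computable.fst.comp Computable.snd)))
      (Computable.snd.comp Computable.snd)
  · rintro ⟨a, n⟩
    induction n with
    | zero => simp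
    | succ n ih =>
      simp only [Bool.and_eq_true, decide_eq_true_eq] at ih ⊢
      rw [← ih]
      simp only [Nat.lt_succ_iff_lt_or_eq]
      constructor
      · exact fun h => ⟨h n (Or.inr rfl), fun i hi => h i (Or.inl hi)⟩
      · rintro ⟨h1, h2⟩ i (hi | rfl)
        exacts [h2 i hi, h1]

variable {k : ℕ} {p q : α → Prop}

theorem isPi0_not_iff : IsPi0 k (fun a => ¬ p a) ↔ IsSigma0 k p := by
  simp [IsPi0]

theorem isPi0_zero_iff : IsPi0 0 p ↔ ComputablePred p :=
  ⟨fun h => by simpa using ComputablePred.not h, fun h => ComputablePred.not h⟩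

theorem isSigma0_succ_iff :
    IsSigma0 (k + 1) p ↔ ∃ q : α × ℕ → Prop, IsPi0 k q ∧ ∀ a, p a ↔ ∃ y, q (a, y) := by
  constructor
  · rintro ⟨q, hq, h⟩
    exact ⟨fun x => ¬ q x, isPi0_not_iff.2 hq, h⟩
  · rintro ⟨q, hq, h⟩
    exact ⟨fun x => ¬ q x, hq, by simpa using h⟩

theorem IsSigma0.of_iff (hp : IsSigma0 k p) (h : ∀ a, q a ↔ p a) : IsSigma0 k q := by
  rwa [show q = p from funext fun a => propext (h a)]

theorem IsPi0.of_iff (hp : IsPi0 k p) (h : ∀ a, q a ↔ p a) : IsPi0 k q := by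
  rwa [show q = p from funext fun a => propext (h a)]

theorem IsSigma0.comp (hp : IsSigma0 k p) {f : β → α} (hf : Computable f) :
    IsSigma0 k fun b => p (f b) := by
  induction k generalizing α β with
  | zero => exact ComputablePred.comp' hp hf
  | succ k ih =>
    obtain ⟨q, hq, h⟩ := hp
    refine ⟨fun x : β × ℕ => q (f x.1, x.2), ih hq ?_, fun b => h (f b)⟩
    exact Computable.pair (hf.comp Computable.fst) Computable.snd

theorem IsPi0.comp (hp : IsPi0 k p) {f : β → α} (hf : Computable f) :
    IsPi0 k fun b => p (f b) :=
  IsSigma0.comp (p := fun a => ¬ p a) hp hf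

theorem IsPi0.sigma_succ (hp : IsPi0 k p) : IsSigma0 (k + 1) p :=
  isSigma0_succ_iff.2 ⟨fun x => p x.1, hp.comp Computable.fst, by simp⟩

theorem IsSigma0.pi_succ (hp : IsSigma0 k p) : IsPi0 (k + 1) p :=
  (isPi0_not_iff.2 hp).sigma_succ

theorem IsSigma0.succ (hp : IsSigma0 k p) : IsSigma0 (k + 1) p := by
  induction k generalizing α with
  | zero => exact (isPi0_zero_iff.2 hp).sigma_succ
  | succ k ih =>
    obtain ⟨q, hq, h⟩ := hp
    exact ⟨q, ih hq, h⟩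

theorem IsPi0.succ (hp : IsPi0 k p) : IsPi0 (k + 1) p := IsSigma0.succ (p := fun a => ¬ p a) hp

theorem IsSigma0.mono (hp : IsSigma0 k p) {l : ℕ} (h : k ≤ l) : IsSigma0 l p := by
  induction h with
  | refl => exact hp
  | step _ ih => exact ih.succ

theorem IsPi0.mono (hp : IsPi0 k p) {l : ℕ} (h : k ≤ l) : IsPi0 l p :=
  IsSigma0.mono (p := fun a => ¬ p a) hp h

theorem IsPi0.sigma_of_lt (hp : IsPi0 k p) {l : ℕ} (h : k < l) : IsSigma0 l p :=
  hp.sigma_succ.mono h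

theorem _root_.ComputablePred.sigma (hp : ComputablePred p) (k : ℕ) : IsSigma0 k p :=
  IsSigma0.mono (k := 0) hp (Nat.zero_le k)

theorem _root_.ComputablePred.pi (hp : ComputablePred p) (k : ℕ) : IsPi0 k p :=
  ComputablePred.sigma (p := fun a => ¬ p a) hp.not k

theorem computable_unpair_fst : Computable fun w : ℕ => w.unpair.1 :=
  Computable.fst.comp Computable.unpair

theorem computable_unpair_snd : Computable fun w : ℕ => w.unpair.2 :=
  Computable.snd.comp Computable.unpair

/-- The complement in the definition of `IsSigma0` swaps the connectives at each level, so neither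
closure property can be proved by induction alone. -/
theorem isSigma0_and_or (hp : IsSigma0 k p) (hq : IsSigma0 k q) :
    IsSigma0 k (fun a => p a ∧ q a) ∧ IsSigma0 k (fun a => p a ∨ q a) := by
  induction k generalizing α with
  | zero =>
    refine ⟨ComputablePred.and' hp hq, ?_⟩
    refine IsSigma0.of_iff (p := fun a => ¬ (¬ p a ∧ ¬ q a)) ?_ fun a => by tauto
    exact (ComputablePred.and' hp.not hq.not).not
  | succ k ih =>
    obtain ⟨p', hp', h1⟩ := hp
    obtain ⟨q', hq', h2⟩ := hq
    constructor
    · refine ⟨fun x => p' (x.1, x.2.unpair.1) ∨ q' (x.1, x.2.unpair.2), (ih ?_ ?_).2, fun a => ?_⟩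
      · exact hp'.comp (Computable.pair Computable.fst
          (computable_unpair_fst.comp Computable.snd))
      · exact hq'.comp (Computable.pair Computable.fst
          (computable_unpair_snd.comp Computable.snd))
      · simp only [h1, h2]
        constructor
        · rintro ⟨⟨y, hy⟩, z, hz⟩
          exact ⟨Nat.pair y z, by simp [hy, hz]⟩
        · rintro ⟨w, hw⟩
          push Not at hw
          exact ⟨⟨_, hw.1⟩, _, hw.2⟩
    · refine ⟨fun x => p' x ∧ q' x, (ih hp' hq').1, fun a => ?_⟩
      simp only [h1, h2, ← exists_or]
      exact exists_congr fun y => by tauto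

theorem IsSigma0.and (hp : IsSigma0 k p) (hq : IsSigma0 k q) : IsSigma0 k fun a => p a ∧ q a :=
  (isSigma0_and_or hp hq).1

theorem IsSigma0.or (hp : IsSigma0 k p) (hq : IsSigma0 k q) : IsSigma0 k fun a => p a ∨ q a :=
  (isSigma0_and_or hp hq).2

theorem IsPi0.and (hp : IsPi0 k p) (hq : IsPi0 k q) : IsPi0 k fun a => p a ∧ q a :=
  IsSigma0.of_iff (IsSigma0.or hp hq) fun a => by tauto

theorem IsPi0.or (hp : IsPi0 k p) (hq : IsPi0 k q) : IsPi0 k fun a => p a ∨ q a :=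
  IsSigma0.of_iff (IsSigma0.and hp hq) fun a => by tauto

theorem IsPi0.imp (hp : IsSigma0 k p) (hq : IsPi0 k q) : IsPi0 k fun a => p a → q a :=
  IsPi0.of_iff (IsPi0.or (isPi0_not_iff.2 hp) hq) fun a => by tauto

/-! ### Quantifiers, bounded quantifiers and canonical witnesses -/

theorem IsSigma0.exists_nat {p : α → ℕ → Prop} (hp : IsSigma0 (k + 1) fun x : α × ℕ => p x.1 x.2) :
    IsSigma0 (k + 1) fun a => ∃ y, p a y := by
  obtain ⟨q, hq, h⟩ := hp
  refine ⟨fun x => q ((x.1, x.2.unpair.1), x.2.unpair.2), hq.comp ?_, fun a => ?_⟩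
  · exact Computable.pair (Computable.pair Computable.fst
      (computable_unpair_fst.comp Computable.snd)) (computable_unpair_snd.comp Computable.snd)
  · constructor
    · rintro ⟨y, hy⟩
      obtain ⟨z, hz⟩ := (h (a, y)).1 hy
      exact ⟨Nat.pair y z, by simpa using hz⟩
    · rintro ⟨w, hw⟩
      exact ⟨_, (h (a, _)).2 ⟨_, hw⟩⟩

theorem IsSigma0.exists [Inhabited β] {p : α → β → Prop}
    (hp : IsSigma0 (k + 1) fun x : α × β => p x.1 x.2) : IsSigma0 (k + 1) fun a => ∃ y, p a y := by
  have h : IsSigma0 (k + 1) fun x : α × ℕ => p x.1 ((Encodable.decode x.2).getD default) :=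
    hp.comp (f := fun x : α × ℕ => (x.1, ((Encodable.decode x.2).getD default : β)))
      (Computable.pair Computable.fst
        (Computable.option_getD (Computable.decode.comp Computable.snd) (Computable.const default)))
  refine IsSigma0.of_iff (IsSigma0.exists_nat
    (p := fun a n => p a ((Encodable.decode n).getD default)) h) fun a => ⟨?_, ?_⟩
  · rintro ⟨y, hy⟩
    exact ⟨Encodable.encode y, by simpa using hy⟩
  · rintro ⟨n, hn⟩
    exact ⟨_, hn⟩

theorem IsPi0.forall [Inhabited β] {p : α → β → Prop}
    (hp : IsPi0 (k + 1) fun x : α × β => p x.1 x.2) : IsPi0 (k + 1) fun a => ∀ y, p a y :=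
  IsSigma0.of_iff (IsSigma0.exists (p := fun a y => ¬ p a y) hp) fun a => by simp

/-- The finitely many witnesses of a bounded quantifier are collected in a list. -/
theorem forall_lt_exists_iff {P : ℕ → ℕ → Prop} {n : ℕ} :
    (∀ i < n, ∃ y, P i y) ↔ ∃ c : List ℕ, ∀ i < n, P i (c.getD i 0) := by
  constructor
  · intro h
    choose! f hf using h
    refine ⟨(List.range n).map f, fun i hi => ?_⟩
    simpa [List.getD, hi] using hf i hi
  · rintro ⟨c, hc⟩ i hi
    exact ⟨_, hc i hi⟩

theorem computable_getD : Computable₂ fun (c : List ℕ) (i : ℕ) => c.getD i 0 :=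
  (Primrec.list_getD 0).to_comp

/-- A bounded search is decidable at level 0; above it, the bounded quantifier is absorbed by the
leading universal one. -/
theorem isPi0_forall_lt_aux {p : α × ℕ → Prop} (hp : IsPi0 k p) :
    IsPi0 k fun x : α × ℕ => ∀ i < x.2, p (x.1, i) := by
  cases k with
  | zero => exact isPi0_zero_iff.2 (ComputablePred.forall_lt' (isPi0_zero_iff.1 hp))
  | succ k =>
    refine IsPi0.forall (p := fun (x : α × ℕ) i => i < x.2 → p (x.1, i)) (IsPi0.imp ?_ ?_)
    · refine ComputablePred.sigma (PrimrecPred.computablePred ?_) _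
      exact Primrec.nat_lt.comp Primrec.snd (Primrec.snd.comp Primrec.fst)
    · exact hp.comp (Computable.pair (Computable.fst.comp Computable.fst) Computable.snd)

theorem IsPi0.forall_lt {p : α → ℕ → Prop} (hp : IsPi0 k fun x : α × ℕ => p x.1 x.2) {f : α → ℕ}
    (hf : Computable f) : IsPi0 k fun a => ∀ i < f a, p a i :=
  (isPi0_forall_lt_aux hp).comp (f := fun a => (a, f a)) (Computable.pair Computable.id hf)

theorem IsSigma0.forall_lt {p : α → ℕ → Prop} (hp : IsSigma0 k fun x : α × ℕ => p x.1 x.2)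
    {f : α → ℕ} (hf : Computable f) : IsSigma0 k fun a => ∀ i < f a, p a i := by
  cases k with
  | zero =>
    exact ComputablePred.comp' (ComputablePred.forall_lt' hp) (f := fun a => (a, f a))
      (Computable.pair Computable.id hf)
  | succ k =>
    obtain ⟨q, hq, h⟩ := isSigma0_succ_iff.1 hp
    have h1 : IsPi0 k fun x : α × List ℕ => ∀ i < f x.1, q ((x.1, i), x.2.getD i 0) := by
      refine IsPi0.forall_lt (p := fun (x : α × List ℕ) i => q ((x.1, i), x.2.getD i 0)) ?_
        (hf.comp Computable.fst)
      refine hq.comp (Computable.pair (Computable.pair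
        (Computable.fst.comp Computable.fst) Computable.snd) ?_)
      exact computable_getD.comp (Computable.snd.comp Computable.fst) Computable.snd
    refine IsSigma0.of_iff (IsSigma0.exists
      (p := fun a (c : List ℕ) => ∀ i < f a, q ((a, i), c.getD i 0)) h1.sigma_succ) fun a => ?_
    rw [← forall_lt_exists_iff (P := fun i y => q ((a, i), y))]
    exact forall₂_congr fun i _ => h (a, i)

/-- Witnesses of a `Σ⁰_{k+1}` predicate can be made unique. -/
theorem IsSigma0.exists_unique_witness (hp : IsSigma0 (k + 1) p) :
    ∃ q : α × ℕ → Prop, IsPi0 k q ∧ (∀ a, p a ↔ ∃ y, q (a, y)) ∧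
      ∀ a y z, q (a, y) → q (a, z) → y = z := by
  induction k generalizing α with
  | zero =>
    obtain ⟨q, hq, h⟩ := isSigma0_succ_iff.1 hp
    have hq' := isPi0_zero_iff.1 hq
    -- At the first level the least witness is canonical, and its minimality is decidable.
    refine ⟨fun x => q x ∧ ∀ i < x.2, ¬ q (x.1, i), hq.and ?_, fun a => ?_, ?_⟩
    · exact isPi0_zero_iff.2 (ComputablePred.forall_lt' (p := fun x => ¬ q x) hq'.not)
    · rw [h]
      constructor
      · intro hy
        classical
        exact ⟨Nat.find hy, Nat.find_spec hy, fun i hi => Nat.find_min hy hi⟩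
      · rintro ⟨y, hy⟩
        exact ⟨y, hy.1⟩
    · rintro a y z ⟨h1, h2⟩ ⟨h3, h4⟩
      rcases lt_trichotomy y z with hlt | heq | hlt
      exacts [absurd h1 (h4 _ hlt), heq, absurd h3 (h2 _ hlt)]
  | succ k ih =>
    obtain ⟨q, hq, h⟩ := hp
    obtain ⟨r, hr, hr1, hr2⟩ := ih hq
    -- The canonical witness is the least `y` with `¬ q (a, y)`, paired with the list of the unique
    -- certificates of `q (a, i)` for `i < y`. Stating minimality directly would be `Σ⁰_{k+1}`;
    -- listing the certificates makes it `Π⁰_k`. The length condition makes the list unique.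
    let q' : α × ℕ → Prop := fun x =>
      ¬ q (x.1, x.2.unpair.1) ∧ (Denumerable.ofNat (List ℕ) x.2.unpair.2).length = x.2.unpair.1 ∧
        ∀ i < x.2.unpair.1, r ((x.1, i), (Denumerable.ofNat (List ℕ) x.2.unpair.2).getD i 0)
    have c1 : Computable fun x : α × ℕ => x.2.unpair.1 := computable_unpair_fst.comp Computable.snd
    have c2 : Computable fun x : α × ℕ => Denumerable.ofNat (List ℕ) x.2.unpair.2 :=
      (Computable.ofNat _).comp (computable_unpair_snd.comp Computable.snd)
    refine ⟨q', IsPi0.and ?_ (IsPi0.and ?_ ?_), fun a => ?_, ?_⟩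
    · exact isPi0_not_iff.2 (hq.comp (Computable.pair Computable.fst c1))
    · refine ComputablePred.pi ?_ _
      exact ComputablePred.comp' (p := fun x : ℕ × ℕ => x.1 = x.2)
        (PrimrecPred.computablePred Primrec.eq) (Computable.pair (Computable.list_length.comp c2) c1)
    · refine IsPi0.forall_lt (p := fun (x : α × ℕ) i =>
        r ((x.1, i), (Denumerable.ofNat (List ℕ) x.2.unpair.2).getD i 0)) ?_ c1
      refine hr.succ.comp (Computable.pair (Computable.pair
        (Computable.fst.comp Computable.fst) Computable.snd) ?_)
      exact computable_getD.comp (c2.comp Computable.fst) Computable.snd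
    · rw [h]
      constructor
      · intro hy
        classical
        have hmin : ∀ i < Nat.find hy, ∃ c, r ((a, i), c) := fun i hi =>
          (hr1 (a, i)).1 (not_not.1 (Nat.find_min hy hi))
        choose! f hf using hmin
        refine ⟨Nat.pair (Nat.find hy)
          (Encodable.encode ((List.range (Nat.find hy)).map f)), ?_⟩
        simp only [q', Nat.unpair_pair, Denumerable.ofNat_encode]
        refine ⟨Nat.find_spec hy, by simp, fun i hi => ?_⟩
        have := hf i hi
        rw [List.getD_eq_getElem _ _ (by simpa using hi)]
        simpa using this
      · rintro ⟨y, hy⟩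
        exact ⟨_, hy.1⟩
    · rintro a y z ⟨hy1, hy2, hy3⟩ ⟨hz1, hz2, hz3⟩
      have h1 : y.unpair.1 = z.unpair.1 := by
        rcases lt_trichotomy y.unpair.1 z.unpair.1 with hlt | heq | hlt
        · exact absurd ((hr1 (a, _)).2 ⟨_, hz3 _ hlt⟩) hy1
        · exact heq
        · exact absurd ((hr1 (a, _)).2 ⟨_, hy3 _ hlt⟩) hz1
      have h2 : Denumerable.ofNat (List ℕ) y.unpair.2 = Denumerable.ofNat (List ℕ) z.unpair.2 := by
        refine List.ext_getElem (by simp only [hy2, hz2, h1]) fun i hi hi' => ?_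
        have := hr2 (a, i) _ _ (hy3 i (hy2 ▸ hi)) (hz3 i (hz2 ▸ hi'))
        rwa [List.getD_eq_getElem _ _ hi, List.getD_eq_getElem _ _ hi'] at this
      have h3 : y.unpair.2 = z.unpair.2 := by
        simpa using congrArg Encodable.encode h2
      rw [← Nat.pair_unpair y, ← Nat.pair_unpair z, h1, h3]

/-- A `Π⁰_{k+2}` predicate says that some `Π⁰_k` predicate has infinitely many solutions. -/
theorem IsPi0.exists_infinite (hp : IsPi0 (k + 2) p) :
    ∃ q : α × ℕ → Prop, IsPi0 k q ∧ ∀ a, p a ↔ {y | q (a, y)}.Infinite := by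
  obtain ⟨q, hq, h⟩ := hp
  obtain ⟨r, hr, hr1, hr2⟩ := hq.exists_unique_witness
  let L : ℕ → List ℕ := Denumerable.ofNat (List ℕ)
  have hL : Computable L := Computable.ofNat _
  -- The solutions are the lists of certificates of `q (a, 0), …, q (a, m - 1)`. There is at most
  -- one of each length; all lengths occur if `q (a, i)` holds for every `i`, and otherwise the
  -- lengths are bounded.
  let c : α × ℕ → Prop := fun x => ∀ i < (L x.2).length, r ((x.1, i), (L x.2).getD i 0)
  refine ⟨c, ?_, fun a => ?_⟩
  · refine IsPi0.forall_lt (p := fun (x : α × ℕ) i => r ((x.1, i), (L x.2).getD i 0)) ?_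
      (Computable.list_length.comp (hL.comp Computable.snd))
    refine hr.comp (Computable.pair (Computable.pair
      (Computable.fst.comp Computable.fst) Computable.snd) ?_)
    exact computable_getD.comp (hL.comp (Computable.snd.comp Computable.fst)) Computable.snd
  · have hpa : p a ↔ ∀ i, q (a, i) := by
      have : ¬ p a ↔ _ := h a
      rw [← not_iff_not, this]
      simp
    rw [hpa]
    have hinj : Set.InjOn (fun y => (L y).length) {y | c (a, y)} := by
      intro y hy z hz hyz
      have h2 : L y = L z := by
        refine List.ext_getElem hyz fun i hi hi' => ?_
        have := hr2 (a, i) _ _ (hy i hi) (hz i hi')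
        rwa [List.getD_eq_getElem _ _ hi, List.getD_eq_getElem _ _ hi'] at this
      simpa [L] using congrArg Encodable.encode h2
    constructor
    · intro hall
      choose f hf using fun i => (hr1 (a, i)).1 (hall i)
      refine Set.infinite_of_injective_forall_mem
        (f := fun n => Encodable.encode ((List.range n).map f)) ?_ fun n => ?_
      · intro m n hmn
        simpa using congrArg List.length (Encodable.encode_injective hmn)
      · simp only [Set.mem_ofPred_eq, c, L, Denumerable.ofNat_encode]
        intro i hi
        rw [List.getD_eq_getElem _ _ hi]
        simpa using hf i
    · intro hinf i
      by_contra hi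
      refine hinf (Set.Finite.of_finite_image ((Set.finite_Iic i).subset ?_) hinj)
      rintro _ ⟨y, hy, rfl⟩
      by_contra hlt
      exact hi ((hr1 (a, i)).2 ⟨_, hy i (by simpa using hlt)⟩)

end Hierarchy

/-! ## Matching fibers and gluing isomorphisms -/

section Gluing

/-- Countability is essential: `encard` does not separate infinite cardinals. -/
theorem nonempty_equiv_of_encard_eq {α β : Type} [Countable α] [Countable β] {s : Set α} {t : Set β}
    (h : s.encard = t.encard) : Nonempty (s ≃ t) := by
  have h' : Cardinal.toENat (Cardinal.mk s) = Cardinal.toENat (Cardinal.mk t) := h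
  exact Cardinal.eq.1 (Cardinal.toENat_injOn (Cardinal.mk_le_aleph0 (α := s))
    (Cardinal.mk_le_aleph0 (α := t)) h')

/-- Two colourings of countable sets with equinumerous colour classes differ by a bijection. -/
theorem exists_equiv_of_fibers {α β τ : Type} [Countable α] [Countable β] (f : α → τ) (g : β → τ)
    (h : ∀ t, {a | f a = t}.encard = {b | g b = t}.encard) :
    ∃ e : α ≃ β, ∀ a, g (e a) = f a := by
  let e := fun t => (nonempty_equiv_of_encard_eq (h t)).some
  refine ⟨(Equiv.sigmaFiberEquiv f).symm.trans
    ((Equiv.sigmaCongrRight fun t => (e t)).trans (Equiv.sigmaFiberEquiv g)), fun a => ?_⟩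
  exact (e (f a) ⟨a, rfl⟩).2

/-- An `m`-element subset of a fiber, written as a list, is matched with `m` distinct elements of
the corresponding fiber; inequalities in `ℕ∞` are tested on natural numbers `m`. -/
theorem encard_fiber_le_of_lists {α β τ : Type} (f : α → τ) (g : β → τ)
    (h : ∀ l : List α, l.Nodup → ∃ l' : List β, l'.Nodup ∧
      List.Forall₂ (fun a b => f a = g b) l l') (t : τ) :
    {a | f a = t}.encard ≤ {b | g b = t}.encard := by
  refine ENat.forall_natCast_le_iff_le.1 fun m hm => ?_
  obtain ⟨s, hs, hsm⟩ := Set.exists_subset_encard_eq hm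
  have hfin : s.Finite := Set.finite_of_encard_eq_coe hsm
  classical
  obtain ⟨l', hl', hrel⟩ := h hfin.toFinset.toList (Finset.nodup_toList _)
  have hsub : (l'.toFinset : Set β) ⊆ {b | g b = t} := by
    intro b hb
    have hb' : b ∈ l' := by simpa using hb
    obtain ⟨i, hi, rfl⟩ := List.getElem_of_mem hb'
    have hi' := hrel.length_eq ▸ hi
    have h1 := (List.forall₂_iff_get.1 hrel).2 i hi' hi
    have h2 : hfin.toFinset.toList.get ⟨i, hi'⟩ ∈ s := by
      have := List.get_mem hfin.toFinset.toList ⟨i, hi'⟩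
      simpa only [Finset.mem_toList, Set.Finite.mem_toFinset] using this
    exact h1.symm.trans (hs h2)
  refine le_trans (le_of_eq ?_) (Set.encard_le_encard hsub)
  rw [Set.encard_coe_eq_coe_finsetCard, List.toFinset_card_of_nodup hl', ← hrel.length_eq,
    Finset.length_toList, ← hsm, ← Set.encard_coe_eq_coe_finsetCard, hfin.coe_toFinset]

/-- The order obtained from a family of orders by adding a new least element to their disjoint
union. -/
def Join {ι : Type} {S : ι → Type} (r : ∀ i, S i → S i → Prop) :
    Option (Σ i, S i) → Option (Σ i, S i) → Prop
  | none, _ => True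
  | some _, none => False
  | some a, some b => ∃ h : a.1 = b.1, r b.1 (h ▸ a.2) b.2

theorem join_some_iff {ι : Type} {S : ι → Type} {r : ∀ i, S i → S i → Prop} {i : ι} {a b : S i} :
    Join r (some ⟨i, a⟩) (some ⟨i, b⟩) ↔ r i a b := by
  simp [Join]

theorem Join.nonempty_relIso {ι κ : Type} {S : ι → Type} {T : κ → Type}
    {r : ∀ i, S i → S i → Prop} {s : ∀ i, T i → T i → Prop} (e : ι ≃ κ)
    (h : ∀ i, Nonempty (r i ≃r s (e i))) : Nonempty (Join r ≃r Join s) := by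
  let φ := fun i => (h i).some
  refine ⟨⟨Equiv.optionCongr (Equiv.sigmaCongr e fun i => (φ i).toEquiv), ?_⟩⟩
  rintro (_ | ⟨i, a⟩) (_ | ⟨j, b⟩)
  · simp [Join]
  · simp [Join]
  · simp [Join]
  · change Join s (some ⟨e i, φ i a⟩) (some ⟨e j, φ j b⟩) ↔ _
    by_cases hij : i = j
    · subst hij
      rw [join_some_iff, join_some_iff]
      exact (φ i).map_rel_iff
    · simp [Join, hij]

end Gluing

/-! ## Trees of lists -/

section Lists

theorem isTree_of_prefix {V : Type} {le : V → V → Prop} (g : V → List ℕ)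
    (hg : Function.Injective g) (hle : ∀ x y, le x y ↔ g x <+: g y) {r : V} (hr : g r = []) :
    IsTree le where
  refl x := (hle x x).2 List.prefix_rfl
  antisymm x y h1 h2 := hg <| by
    have h1 := (hle x y).1 h1
    exact h1.eq_of_length (le_antisymm h1.length_le ((hle y x).1 h2).length_le)
  trans x y z h1 h2 := (hle x z).2 (((hle x y).1 h1).trans ((hle y z).1 h2))
  exists_root := ⟨r, fun x => (hle r x).2 (hr ▸ List.nil_prefix)⟩
  finite_ancestors x := by
    refine Set.Finite.of_finite_image (f := g) ?_ hg.injOn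
    refine (List.finite_toSet (g x).inits).subset ?_
    rintro _ ⟨y, hy, rfl⟩
    simpa using (hle y x).1 hy
  linear_ancestors x y z h1 h2 := by
    rw [hle, hle]
    exact List.prefix_or_prefix_of_prefix ((hle y x).1 h1) ((hle z x).1 h2)

theorem height_le_of_prefix {V : Type} {le : V → V → Prop} (g : V → List ℕ)
    (hg : Function.Injective g) (hle : ∀ x y, le x y ↔ g x <+: g y) {n : ℕ}
    (hn : ∀ x, (g x).length ≤ n) : height le ≤ n := by
  refine iSup_le fun x => ?_
  refine le_trans ?_ (Nat.cast_le.2 (hn x))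
  -- Prefixes of one list are determined by their lengths, and proper ones are shorter.
  have hinj : Set.InjOn (fun y => (g y).length) {y | le y x ∧ y ≠ x} := by
    intro y hy z hz hyz
    have h1 := (hle y x).1 hy.1
    have h2 := (hle z x).1 hz.1
    exact hg ((List.prefix_of_prefix_length_le h1 h2 hyz.le).eq_of_length hyz)
  rw [level, ← hinj.encard_image]
  have hsub : (fun y => (g y).length) '' {y | le y x ∧ y ≠ x} ⊆
      (Finset.range (g x).length : Set ℕ) := by
    rintro _ ⟨y, ⟨hy, hne⟩, rfl⟩
    have h1 := (hle y x).1 hy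
    simp only [Finset.coe_range, Set.mem_Iio]
    refine lt_of_le_of_ne h1.length_le fun heq => hne (hg (h1.eq_of_length heq))
  refine (Set.encard_le_encard hsub).trans ?_
  rw [Set.encard_coe_eq_coe_finsetCard]
  simp

end Lists

/-! ## Trees coding nested infinity quantifiers -/

section Coding

/-- `InfQuant k R`: there are infinitely many `b₁` such that there are infinitely many `b₂`
such that … there are infinitely many `b_k` with `R [b₁, …, b_k]`. -/
def InfQuant : ℕ → (List ℕ → Prop) → Prop
  | 0, R => R []
  | k + 1, R => {b | InfQuant k fun s => R (b :: s)}.Infinite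

/-- The predicate on lists whose first entry is below `m`. -/
def HeadLT (m : ℕ) (s : List ℕ) : Prop := ∃ c ∈ s.head?, c < m

/-- The predicate coded by the `b`-th child of a tree coding `R`: the children with even numbers
code the sections of `R`, and those with odd numbers the predicates `HeadLT m`, each infinitely
often. -/
def childPred (R : List ℕ → Prop) (b : ℕ) : List ℕ → Prop :=
  if b % 2 = 0 then fun s => R (b / 2 :: s) else HeadLT (b / 2).unpair.1

/-- The predicate coded by the node `s` of the tree coding `R`. -/
def nodePred (R : List ℕ → Prop) (s : List ℕ) : List ℕ → Prop := s.foldl childPred R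

/-- The nodes of the tree coding `R`: the lists of length less than `k`, and those lists of
length `k` at which the coded predicate holds. -/
def IsNode (k : ℕ) (R : List ℕ → Prop) (s : List ℕ) : Prop :=
  s.length < k ∨ s.length = k ∧ nodePred R s []

abbrev Node (k : ℕ) (R : List ℕ → Prop) : Type := {s // IsNode k R s}

def nodeLE (k : ℕ) (R : List ℕ → Prop) (a b : Node k R) : Prop := a.1 <+: b.1

/-! ### The invariant of a coding tree and the effect of the padding -/

theorem infQuant_const {k : ℕ} {p : Prop} : InfQuant k (fun _ => p) ↔ p := by
  induction k with
  | zero => rfl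
  | succ k ih =>
    simp only [InfQuant, ih]
    by_cases hp : p
    · simp [hp, Set.infinite_univ]
    · simp [hp]

theorem setOf_infQuant_headLT (k m : ℕ) :
    {b | InfQuant k fun s => HeadLT m (b :: s)} = Set.Iio m := by
  ext b
  simp [HeadLT, infQuant_const]

/-- Padding children never count towards the infinity quantifiers. -/
theorem not_infQuant_headLT (k m : ℕ) : ¬ InfQuant k (HeadLT m) := by
  cases k with
  | zero => simp [InfQuant, HeadLT]
  | succ k =>
    rw [InfQuant, setOf_infQuant_headLT]
    exact Set.not_infinite.2 (Set.finite_Iio m)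

theorem infQuant_childPred_iff {k : ℕ} {R : List ℕ → Prop} {b : ℕ} :
    InfQuant k (childPred R b) ↔ ∃ c, InfQuant k (fun s => R (c :: s)) ∧ 2 * c = b := by
  unfold childPred
  split_ifs with h
  · constructor
    · exact fun hb => ⟨b / 2, hb, by omega⟩
    · rintro ⟨c, hc, rfl⟩
      simpa using hc
  · refine iff_of_false (not_infQuant_headLT _ _) ?_
    rintro ⟨c, -, rfl⟩
    omega

theorem setOf_infQuant_childPred (k : ℕ) (R : List ℕ → Prop) :
    {b | InfQuant k (childPred R b)} =
      (fun c => 2 * c) '' {c | InfQuant k fun s => R (c :: s)} := by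
  ext b
  exact infQuant_childPred_iff

theorem two_mul_injective : Function.Injective fun c : ℕ => 2 * c :=
  fun a b h => by simpa using h

/-- The invariant that determines the isomorphism type of the tree coding `R`. -/
noncomputable def infCount : ℕ → (List ℕ → Prop) → ℕ∞
  -- The values `⊤` and `0` are chosen so that `⊤` means `InfQuant` at level 0 too.
  | 0, R => by classical exact if R [] then ⊤ else 0
  | k + 1, R => {b | InfQuant k fun s => R (b :: s)}.encard

theorem infCount_eq_top_iff {k : ℕ} {R : List ℕ → Prop} : infCount k R = ⊤ ↔ InfQuant k R := by
  cases k with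
  | zero => by_cases h : R [] <;> simp [infCount, InfQuant, h]
  | succ k => simp [infCount, InfQuant]

/-- Every finite value is realized by a padding predicate, except at level 0, where the empty list
has no head and only `0` is available. -/
theorem infCount_headLT (k m : ℕ) : infCount k (HeadLT m) = if k = 0 then 0 else (m : ℕ∞) := by
  cases k with
  | zero => simp [infCount, HeadLT]
  | succ k =>
    rw [infCount, setOf_infQuant_headLT, ← Finset.coe_Iio, Set.encard_coe_eq_coe_finsetCard]
    simp

theorem encard_infCount_childPred_eq_top (k : ℕ) (R : List ℕ → Prop) :
    {b | infCount k (childPred R b) = ⊤}.encard = infCount (k + 1) R := by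
  simp only [infCount_eq_top_iff]
  rw [setOf_infQuant_childPred, infCount]
  exact two_mul_injective.encard_image _

/-- The padding hides the sections with finite invariant: each finite value already occurs
infinitely often, whatever `R` is. At `k = 0` the only finite value is `0`. -/
theorem encard_infCount_childPred_eq_coe (k m : ℕ) (R : List ℕ → Prop) :
    {b | infCount k (childPred R b) = m}.encard = if k = 0 ∧ m ≠ 0 then 0 else ⊤ := by
  split_ifs with h
  · obtain ⟨rfl, hm⟩ := h
    rw [Set.encard_eq_zero, Set.eq_empty_iff_forall_notMem]
    intro b hb
    simp only [infCount, Set.mem_ofPred_eq] at hb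
    split_ifs at hb
    · exact ENat.top_ne_natCast m hb
    · exact hm (by exact_mod_cast hb.symm)
  · rw [Set.encard_eq_top_iff]
    -- The odd children whose padding parameter is `m`; the second component `i` supplies the
    -- copies.
    refine Set.infinite_of_injective_forall_mem (f := fun i => 2 * Nat.pair m i + 1) ?_ fun i => ?_
    · intro i j hij
      have : Nat.pair m i = Nat.pair m j := by simpa using hij
      simpa using this
    · have h1 : (2 * Nat.pair m i + 1) % 2 ≠ 0 := by omega
      have h2 : (2 * Nat.pair m i + 1) / 2 = Nat.pair m i := by omega
      simp only [Set.mem_ofPred_eq, childPred, if_neg h1, h2, Nat.unpair_pair, infCount_headLT]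
      by_cases hk : k = 0
      · have hm : m = 0 := by tauto
        simp [hk, hm]
      · simp [hk]

theorem nodePred_cons (R : List ℕ → Prop) (b : ℕ) (s : List ℕ) :
    nodePred R (b :: s) = nodePred (childPred R b) s := rfl

theorem isNode_cons_iff {k : ℕ} {R : List ℕ → Prop} {b : ℕ} {s : List ℕ} :
    IsNode (k + 1) R (b :: s) ↔ IsNode k (childPred R b) s := by
  simp [IsNode, nodePred_cons]

theorem isNode_nil_succ {k : ℕ} {R : List ℕ → Prop} : IsNode (k + 1) R [] :=
  Or.inl (Nat.succ_pos k)

theorem nonempty_relIso_join (k : ℕ) (R : List ℕ → Prop) :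
    Nonempty (nodeLE (k + 1) R ≃r Join fun b => nodeLE k (childPred R b)) := by
  let f : Option (Σ b, Node k (childPred R b)) → Node (k + 1) R := fun o =>
    match o with
    | none => ⟨[], isNode_nil_succ⟩
    | some ⟨b, s⟩ => ⟨b :: s.1, isNode_cons_iff.2 s.2⟩
  have hf : Function.Bijective f := by
    constructor
    · rintro (_ | ⟨b, s, hs⟩) (_ | ⟨c, t, ht⟩) h
      · rfl
      · exact absurd (congrArg Subtype.val h) (List.cons_ne_nil _ _).symm
      · exact absurd (congrArg Subtype.val h) (List.cons_ne_nil _ _)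
      · simp only [f, Subtype.mk.injEq, List.cons.injEq] at h
        obtain ⟨rfl, rfl⟩ := h
        rfl
    · rintro ⟨_ | ⟨b, s⟩, hs⟩
      · exact ⟨none, rfl⟩
      · exact ⟨some ⟨b, s, isNode_cons_iff.1 hs⟩, rfl⟩
  refine ⟨RelIso.symm ⟨Equiv.ofBijective f hf, ?_⟩⟩
  rintro (_ | ⟨b, s, hs⟩) (_ | ⟨c, t, ht⟩)
  · simp [f, nodeLE, Join]
  · simp [f, nodeLE, Join]
  · simp [f, nodeLE, Join]
  · by_cases hbc : b = c
    · subst hbc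
      rw [join_some_iff]
      simp [f, nodeLE, List.cons_prefix_cons]
    · simp [f, nodeLE, Join, List.cons_prefix_cons, hbc]

/-- Colour the children by their invariants. The colour class of `⊤` has the size of the parent's
invariant, and the other classes do not depend on the predicate, so a colour-preserving bijection
exists; the subtrees are isomorphic by induction and are glued along it. -/
theorem nonempty_relIso_of_infCount_eq {k : ℕ} {R R' : List ℕ → Prop}
    (h : infCount k R = infCount k R') : Nonempty (nodeLE k R ≃r nodeLE k R') := by
  induction k generalizing R R' with
  | zero =>
    have hR : R [] ↔ R' [] := by
      have := congrArg (· = ⊤) h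
      simpa [infCount_eq_top_iff, InfQuant] using this
    have hnode : ∀ s, IsNode 0 R s ↔ IsNode 0 R' s := by
      intro s
      simp only [IsNode, not_lt_zero, false_or]
      refine and_congr_right fun hs => ?_
      rw [List.length_eq_zero_iff.1 hs]
      exact hR
    exact ⟨⟨Equiv.subtypeEquivRight hnode, Iff.rfl⟩⟩
  | succ k ih =>
    obtain ⟨e, he⟩ := exists_equiv_of_fibers (fun b => infCount k (childPred R b))
      (fun b => infCount k (childPred R' b)) fun t => by
        induction t using ENat.recTopCoe with
        | top => simpa only [encard_infCount_childPred_eq_top] using h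
        | coe m => simp only [encard_infCount_childPred_eq_coe]
    obtain ⟨φ⟩ := nonempty_relIso_join k R
    obtain ⟨ψ⟩ := nonempty_relIso_join k R'
    obtain ⟨χ⟩ := Join.nonempty_relIso (r := fun b => nodeLE k (childPred R b))
      (s := fun b => nodeLE k (childPred R' b)) e fun b => ih (he b).symm
    exact ⟨(φ.trans χ).trans ψ.symm⟩

/-- `y` is an upper cover of `x`. -/
def Covers {V : Type} (le : V → V → Prop) (x y : V) : Prop :=
  le x y ∧ x ≠ y ∧ ∀ z, le x z → le z y → z = x ∨ z = y

/-- An isomorphism-invariant rank: `x` branches infinitely often `k` levels deep. -/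
def Branching {V : Type} (le : V → V → Prop) : ℕ → V → Prop
  | 0, _ => True
  | k + 1, x => {y | Covers le x y ∧ Branching le k y}.Infinite

/-! ### Recovering the nested quantifiers from the isomorphism type -/

theorem covers_relIso_iff {V W : Type} {r : V → V → Prop} {s : W → W → Prop} (e : r ≃r s)
    {x y : V} : Covers s (e x) (e y) ↔ Covers r x y := by
  unfold Covers
  rw [e.surjective.forall]
  simp only [e.map_rel_iff, ne_eq, EmbeddingLike.apply_eq_iff_eq]

theorem branching_relIso_iff {V W : Type} {r : V → V → Prop} {s : W → W → Prop} (e : r ≃r s)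
    {k : ℕ} {x : V} : Branching s k (e x) ↔ Branching r k x := by
  induction k generalizing x with
  | zero => rfl
  | succ k ih =>
    have : {y | Covers s (e x) y ∧ Branching s k y} =
        e '' {y | Covers r x y ∧ Branching r k y} := by
      ext y
      obtain ⟨y, rfl⟩ := e.surjective y
      simp [covers_relIso_iff, ih]
    rw [Branching, this, Set.infinite_image_iff e.injective.injOn]
    rfl

theorem nodePred_concat (R : List ℕ → Prop) (s : List ℕ) (b : ℕ) :
    nodePred R (s ++ [b]) = childPred (nodePred R s) b := by
  simp [nodePred]

theorem covers_nodeLE_iff {k : ℕ} {R : List ℕ → Prop} {x y : Node k R} :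
    Covers (nodeLE k R) x y ↔ ∃ b, x.1 ++ [b] = y.1 := by
  constructor
  · rintro ⟨⟨t, ht⟩, hne, hmin⟩
    cases t with
    | nil => exact absurd (Subtype.ext (by simpa using ht)) hne
    | cons b t =>
      have hlen := congrArg List.length ht
      simp only [List.length_append, List.length_cons] at hlen
      have hy : y.1.length ≤ k := y.2.elim le_of_lt fun h => h.1.le
      -- There are no gaps: the prefix is either `y` itself or shorter than `k`, and all lists
      -- shorter than `k` are nodes.
      have hz : IsNode k R (x.1 ++ [b]) := by
        rcases Nat.eq_zero_or_pos t.length with h0 | h0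
        · rw [List.length_eq_zero_iff.1 h0] at ht
          exact ht ▸ y.2
        · left
          simp only [List.length_append, List.length_singleton]
          omega
      rcases hmin ⟨_, hz⟩ (List.prefix_append _ _) ⟨t, by simpa using ht⟩ with h | h
      · have := congrArg (fun z => z.1.length) h
        simp at this
      · exact ⟨b, congrArg Subtype.val h⟩
  · rintro ⟨b, hb⟩
    refine ⟨⟨[b], hb⟩, ?_, fun z hxz hzy => ?_⟩
    · rintro rfl
      simpa using congrArg List.length hb
    · have h1 := hxz.length_le
      have h2 := hzy.length_le
      have h3 := congrArg List.length hb
      simp only [List.length_append, List.length_singleton] at h3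
      rcases Nat.lt_or_ge z.1.length y.1.length with h | h
      · exact Or.inl (Subtype.ext (hxz.eq_of_length (by omega)).symm)
      · exact Or.inr (Subtype.ext (hzy.eq_of_length (by omega)))

/-- At full length `n`, membership in the tree is the coded predicate itself. Below that, only even
children can branch deeply enough, and these are the sections of the predicate at `x`. -/
theorem branching_nodeLE_iff {n k : ℕ} {R : List ℕ → Prop} {x : Node n R}
    (h : x.1.length + k = n) : Branching (nodeLE n R) k x ↔ InfQuant k (nodePred R x.1) := by
  induction k generalizing x with
  | zero =>
    refine iff_of_true trivial ?_
    rcases x.2 with h1 | h1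
    · omega
    · exact h1.2
  | succ k ih =>
    have key : (fun y : Node n R => y.1) ''
        {y | Covers (nodeLE n R) x y ∧ Branching (nodeLE n R) k y} =
        (fun b => x.1 ++ [2 * b]) '' {b | InfQuant k fun s => nodePred R x.1 (b :: s)} := by
      ext s
      constructor
      · rintro ⟨y, ⟨hc, hb⟩, rfl⟩
        obtain ⟨b, hy⟩ := covers_nodeLE_iff.1 hc
        have hlen := congrArg List.length hy
        simp only [List.length_append, List.length_singleton] at hlen
        rw [ih (by omega), ← hy, nodePred_concat, infQuant_childPred_iff] at hb
        obtain ⟨c, hc, rfl⟩ := hb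
        exact ⟨c, hc, hy⟩
      · rintro ⟨c, hc, rfl⟩
        have hq : InfQuant k (nodePred R (x.1 ++ [2 * c])) := by
          rw [nodePred_concat, infQuant_childPred_iff]
          exact ⟨c, hc, rfl⟩
        have hnode : IsNode n R (x.1 ++ [2 * c]) := by
          rcases Nat.eq_zero_or_pos k with rfl | hk
          · exact Or.inr ⟨by simpa using h, hq⟩
          · left
            simp only [List.length_append, List.length_singleton]
            omega
        refine ⟨⟨_, hnode⟩, ⟨covers_nodeLE_iff.2 ⟨_, rfl⟩, ?_⟩, rfl⟩
        rw [ih]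
        · exact hq
        · simp only [List.length_append, List.length_singleton]
          omega
    have hinj : Function.Injective fun b => x.1 ++ [2 * b] := fun b c hbc => by simpa using hbc
    rw [Branching, InfQuant, ← Set.infinite_image_iff (Subtype.val_injective.injOn),
      ← Set.infinite_image_iff (f := fun b => x.1 ++ [2 * b]) hinj.injOn]
    exact iff_of_eq (congrArg Set.Infinite key)

theorem nodeLE_nil {k : ℕ} {R : List ℕ → Prop} (h : IsNode k R []) (x : Node k R) :
    nodeLE k R ⟨[], h⟩ x := List.nil_prefix

/-- The tree coding `R` is isomorphic to the one coding the true predicate if and only if the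
nested infinity quantifiers hold. -/
theorem nonempty_relIso_true_iff {n : ℕ} (hn : 1 ≤ n) {R : List ℕ → Prop} :
    Nonempty (nodeLE n R ≃r nodeLE n fun _ => True) ↔ InfQuant n R := by
  constructor
  · rintro ⟨e⟩
    have h1 : IsNode n R [] := Or.inl hn
    have h2 : IsNode n (fun _ => True) [] := Or.inl hn
    have hroot : e ⟨[], h1⟩ = ⟨[], h2⟩ := by
      obtain ⟨y, hy⟩ := e.surjective ⟨[], h2⟩
      have h3 : nodeLE n (fun _ => True) (e ⟨[], h1⟩) (e y) :=
        e.map_rel_iff.2 (nodeLE_nil h1 y)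
      rw [hy] at h3
      exact Subtype.ext (List.prefix_nil.1 h3)
    have h4 := branching_nodeLE_iff (n := n) (k := n) (R := fun _ => True) (x := ⟨[], h2⟩)
      (Nat.zero_add n)
    rw [← hroot, branching_relIso_iff, branching_nodeLE_iff (Nat.zero_add n), hroot] at h4
    exact h4.2 (infQuant_const.2 trivial)
  · intro h
    refine nonempty_relIso_of_infCount_eq ?_
    rw [infCount_eq_top_iff.2 h, infCount_eq_top_iff.2 (infQuant_const.2 trivial)]

end Coding

/-! ## Recursive presentations of the coding trees -/

section Presenting

variable {α : Type} [Primcodable α]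

/-- Nested infinity quantifiers over decidable predicates define all `Π⁰_{2k}` predicates. -/
theorem IsPi0.exists_infQuant {k : ℕ} {p : α → Prop} (hp : IsPi0 (2 * k) p) :
    ∃ R : α × List ℕ → Prop, ComputablePred R ∧ ∀ a, p a ↔ InfQuant k fun s => R (a, s) := by
  induction k generalizing α with
  | zero =>
    exact ⟨fun x => p x.1, (isPi0_zero_iff.1 hp).comp' Computable.fst, fun a => Iff.rfl⟩
  | succ k ih =>
    obtain ⟨q, hq, h⟩ := IsPi0.exists_infinite (k := 2 * k) hp
    obtain ⟨R, hR, hRq⟩ := ih hq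
    -- The default value of `headI` is harmless: `InfQuant (k + 1)` evaluates the predicate only on
    -- nonempty lists.
    refine ⟨fun x => R ((x.1, x.2.headI), x.2.tail), hR.comp' ?_, fun a => ?_⟩
    · exact Computable.pair (Computable.pair Computable.fst
        (Primrec.list_headI.to_comp.comp Computable.snd))
        (Primrec.list_tail.to_comp.comp Computable.snd)
    · rw [h, InfQuant]
      simp only [hRq, List.headI_cons, List.tail_cons]

/-- The state of the scan of a node that computes the predicate coded by it. -/
def scanStep (σ : Option ℕ × List ℕ) (b : ℕ) : Option ℕ × List ℕ :=
  if b % 2 = 0 then (σ.1, σ.2 ++ [b / 2]) else (some (b / 2).unpair.1, [])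

def scan (s : List ℕ) : Option ℕ × List ℕ := s.foldl scanStep (none, [])

/-- `nodePred` folds over predicates; a finite state encoding the current predicate makes it
decidable. The state holds the parameter of the last odd entry, if any, and the halves of the even
entries read since. -/
def scanPred (R : List ℕ → Prop) : Option ℕ × List ℕ → List ℕ → Prop
  | (none, l) => fun t => R (l ++ t)
  | (some m, l) => fun t => HeadLT m (l ++ t)

theorem childPred_scanPred (R : List ℕ → Prop) (σ : Option ℕ × List ℕ) (b : ℕ) :
    childPred (scanPred R σ) b = scanPred R (scanStep σ b) := by
  rcases σ with ⟨_ | m, l⟩ <;> by_cases hb : b % 2 = 0 <;>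
    simp [childPred, scanStep, scanPred, hb]

theorem nodePred_eq_scanPred (R : List ℕ → Prop) (s : List ℕ) :
    nodePred R s = scanPred R (scan s) := by
  have key : ∀ σ, s.foldl childPred (scanPred R σ) = scanPred R (s.foldl scanStep σ) := by
    induction s with
    | nil => exact fun σ => rfl
    | cons b s ih =>
      intro σ
      rw [List.foldl_cons, List.foldl_cons, childPred_scanPred, ih]
  exact key (none, [])

/-- The default `0` of `getD` makes the second alternative impossible when no odd entry was read,
and `≠ []` excludes the default of `headI`. -/
theorem nodePred_nil_iff (R : List ℕ → Prop) (s : List ℕ) :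
    nodePred R s [] ↔ ((scan s).1 = none ∧ R (scan s).2) ∨
      ((scan s).2 ≠ [] ∧ (scan s).2.headI < (scan s).1.getD 0) := by
  rw [nodePred_eq_scanPred]
  rcases scan s with ⟨_ | m, _ | ⟨c, l⟩⟩ <;> simp [scanPred, HeadLT]

theorem primrec_scan : Primrec scan := by
  refine Primrec.list_foldl (h := fun (_ : List ℕ) (x : (Option ℕ × List ℕ) × ℕ) =>
    scanStep x.1 x.2) Primrec.id (Primrec.const _) ?_
  have hb : Primrec fun y : List ℕ × (Option ℕ × List ℕ) × ℕ => y.2.2 :=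
    Primrec.snd.comp Primrec.snd
  have hb2 : Primrec fun y : List ℕ × (Option ℕ × List ℕ) × ℕ => y.2.2 / 2 :=
    Primrec.nat_div.comp hb (Primrec.const 2)
  have hσ : Primrec fun y : List ℕ × (Option ℕ × List ℕ) × ℕ => y.2.1 :=
    Primrec.fst.comp Primrec.snd
  refine Primrec.ite (c := fun y : List ℕ × (Option ℕ × List ℕ) × ℕ => y.2.2 % 2 = 0) ?_ ?_ ?_
  · exact Primrec.eq.comp (Primrec.nat_mod.comp hb (Primrec.const 2)) (Primrec.const 0)
  · exact Primrec.pair (Primrec.fst.comp hσ)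
      (Primrec.list_append.comp (Primrec.snd.comp hσ)
        (Primrec.list_cons.comp hb2 (Primrec.const [])))
  · exact Primrec.pair
      (Primrec.option_some.comp (Primrec.fst.comp (Primrec.unpair.comp hb2))) (Primrec.const [])

theorem computablePred_isNode {R : α × List ℕ → Prop} (hR : ComputablePred R) (n : ℕ) :
    ComputablePred fun x : α × List ℕ => IsNode n (fun s => R (x.1, s)) x.2 := by
  have hlen : Primrec fun x : α × List ℕ => x.2.length := Primrec.list_length.comp Primrec.snd
  have hscan : Primrec fun x : α × List ℕ => scan x.2 := primrec_scan.comp Primrec.snd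
  have h1 : ComputablePred fun x : α × List ℕ => x.2.length < n :=
    (Primrec.nat_lt.comp hlen (Primrec.const n)).computablePred
  have h2 : ComputablePred fun x : α × List ℕ => x.2.length = n :=
    (Primrec.eq.comp hlen (Primrec.const n)).computablePred
  have h3 : ComputablePred fun x : α × List ℕ => (scan x.2).1 = none :=
    (Primrec.eq.comp (Primrec.fst.comp hscan) (Primrec.const none)).computablePred
  have h4 : ComputablePred fun x : α × List ℕ => R (x.1, (scan x.2).2) :=
    hR.comp' (Computable.pair Computable.fst (Primrec.snd.comp hscan).to_comp)
  have h5 : ComputablePred fun x : α × List ℕ => (scan x.2).2 = [] :=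
    (Primrec.eq.comp (Primrec.snd.comp hscan) (Primrec.const [])).computablePred
  have h6 : ComputablePred fun x : α × List ℕ => (scan x.2).2.headI < (scan x.2).1.getD 0 :=
    (Primrec.nat_lt.comp (Primrec.list_headI.comp (Primrec.snd.comp hscan))
      (Primrec.option_getD.comp (Primrec.fst.comp hscan) (Primrec.const 0))).computablePred
  have h7 : IsSigma0 0 fun x : α × List ℕ => _ :=
    IsSigma0.or (k := 0) h1 (IsSigma0.and (k := 0) h2
      (IsSigma0.or (k := 0) (h3.and' h4) (h5.not.and' h6)))
  exact IsSigma0.of_iff h7 fun x => by simp only [IsNode, nodePred_nil_iff, ne_eq]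

theorem Accepts.not_rejects {c : Code} {x : ℕ} (h : Accepts c x) : ¬ Rejects c x := by
  intro h'
  have h1 : Part.some 1 = Part.some 0 := h.symm.trans h'
  exact one_ne_zero (Part.some_injective h1)

/-- A uniformly decidable family of sets is decided by a computable family of programs. -/
theorem exists_deciders {D : ℕ × ℕ → Prop} (hD : ComputablePred D) :
    ∃ g : ℕ → Code, Computable g ∧
      ∀ x, IsDecider (g x) ∧ ∀ v, Accepts (g x) v ↔ D (x, v) := by
  classical
  let F : ℕ → ℕ := fun w => if D w.unpair then 1 else 0
  have hF : Computable F := by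
    have := Computable.cond (hD.decide.comp Computable.unpair) (Computable.const 1)
      (Computable.const 0)
    refine this.of_eq fun w => ?_
    by_cases h : D w.unpair <;> simp [F, h]
  -- One program decides the whole family; currying its first argument is computable in the index.
  obtain ⟨c, hc⟩ := Code.exists_code.1 (Partrec.nat_iff.1 hF.partrec)
  have heval : ∀ x v, (c.curry x).eval v = Part.some (if D (x, v) then 1 else 0) := by
    intro x v
    rw [Code.eval_curry, hc]
    simp [F]
  refine ⟨fun x => c.curry x,
    (Code.primrec₂_curry.comp (Primrec.const c) Primrec.id).to_comp, fun x => ⟨fun v => ?_,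
      fun v => ?_⟩⟩
  · by_cases h : D (x, v)
    · exact Or.inl (by simp [Accepts, heval, h])
    · exact Or.inr (by simp [Rejects, heval, h])
  · by_cases h : D (x, v)
    · exact iff_of_true (by simp [Accepts, heval, h]) h
    · exact iff_of_false (fun h' => h'.not_rejects (by simp [Rejects, heval, h])) h

theorem primrecRel_prefix : PrimrecRel fun s t : List ℕ => s <+: t := by
  refine PrimrecPred.of_eq (p := fun x : List ℕ × List ℕ => x.2.take x.1.length = x.1) ?_ ?_
  · exact Primrec.eq.comp (Primrec.list_take.comp
      (Primrec.list_length.comp Primrec.fst) Primrec.snd) Primrec.fst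
  · rintro ⟨s, t⟩
    rw [eq_comm]
    exact List.prefix_iff_eq_take.symm

/-- The trees coding a uniformly decidable family of predicates are uniformly recursive. -/
theorem exists_presentations {R : ℕ × List ℕ → Prop} (hR : ComputablePred R) {n : ℕ} (hn : 1 ≤ n) :
    ∃ f : ℕ → Presentation, Computable f ∧ ∀ x, (f x).IsTreeOfHeightLE n ∧
      Nonempty ((f x).rel ≃r nodeLE n fun s => R (x, s)) := by
  let L : ℕ → List ℕ := Denumerable.ofNat (List ℕ)
  have hL : Computable L := Computable.ofNat _
  let N : ℕ × ℕ → Prop := fun y => IsNode n (fun s => R (y.1, s)) (L y.2)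
  have hN : ComputablePred N := (computablePred_isNode hR n).comp'
    (f := fun y : ℕ × ℕ => (y.1, L y.2)) (Computable.pair Computable.fst (hL.comp Computable.snd))
  obtain ⟨g, hg, hgN⟩ := exists_deciders hN
  -- Both endpoints are required to be nodes so that the relation is contained in `D × D`.
  let E : ℕ × ℕ → Prop := fun y => N (y.1, y.2.unpair.1) ∧ N (y.1, y.2.unpair.2) ∧
    L y.2.unpair.1 <+: L y.2.unpair.2
  have c1 : Computable fun y : ℕ × ℕ => y.2.unpair.1 := computable_unpair_fst.comp Computable.snd
  have c2 : Computable fun y : ℕ × ℕ => y.2.unpair.2 := computable_unpair_snd.comp Computable.snd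
  have hE : ComputablePred E := by
    refine ComputablePred.and' (hN.comp' (Computable.pair Computable.fst c1))
      (ComputablePred.and' (hN.comp' (Computable.pair Computable.fst c2)) ?_)
    exact ComputablePred.comp' (p := fun z : List ℕ × List ℕ => z.1 <+: z.2)
      primrecRel_prefix.computablePred (Computable.pair (hL.comp c1) (hL.comp c2))
  obtain ⟨h, hh, hhE⟩ := exists_deciders hE
  refine ⟨fun x => (g x, h x), Computable.pair hg hh, fun x => ?_⟩
  have hdom : ∀ v, Accepts (g x) v ↔ IsNode n (fun s => R (x, s)) (L v) := (hgN x).2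
  have hrel : ∀ a b, Accepts (h x) (Nat.pair a b) ↔
      Accepts (g x) a ∧ Accepts (g x) b ∧ L a <+: L b := by
    intro a b
    rw [(hhE x).2, hdom, hdom]
    simp [E, N]
  have hLinj : Function.Injective L := fun a b hab => by
    simpa [L] using congrArg Encodable.encode hab
  let P : Presentation := (g x, h x)
  let G : P.Dom → List ℕ := fun a => L a.1
  have hG : Function.Injective G := fun a b hab => Subtype.ext (hLinj hab)
  have hle : ∀ a b : P.Dom, P.rel a b ↔ G a <+: G b := fun a b =>
    (hrel a.1 b.1).trans ⟨fun h => h.2.2, fun h => ⟨a.2, b.2, h⟩⟩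
  have hnode : ∀ a : P.Dom, IsNode n (fun s => R (x, s)) (G a) := fun a => (hdom a.1).1 a.2
  have hcode : ∀ s, IsNode n (fun s => R (x, s)) s → ∃ a : P.Dom, G a = s := fun s hs =>
    ⟨⟨Encodable.encode s, (hdom _).2 (by simpa [L] using hs)⟩, by simp [G, L]⟩
  obtain ⟨r, hr⟩ := hcode [] (Or.inl hn)
  refine ⟨⟨⟨(hgN x).1, (hhE x).1, fun a b hab => ?_⟩, isTree_of_prefix G hG hle hr,
    height_le_of_prefix G hG hle fun a => ?_⟩, ?_⟩
  · exact ⟨((hrel a b).1 hab).1, ((hrel a b).1 hab).2.1⟩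
  · exact (hnode a).elim le_of_lt fun h => h.1.le
  · let φ : P.Dom → Node n fun s => R (x, s) := fun a => ⟨G a, hnode a⟩
    have hφ : Function.Bijective φ := by
      refine ⟨fun a b hab => hG (congrArg Subtype.val hab), fun s => ?_⟩
      obtain ⟨a, ha⟩ := hcode s.1 s.2
      exact ⟨a, Subtype.ext ha⟩
    exact ⟨⟨Equiv.ofBijective φ hφ, fun {a b} => (hle a b).symm⟩⟩

/-- Every `Π⁰_{2n}` set reduces to the isomorphism of recursive trees of height at most `n`. -/
theorem exists_reduction {n : ℕ} (hn : 1 ≤ n) {B : ℕ → Prop} (hB : IsPi0 (2 * n) B) :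
    ∃ f : ℕ → Presentation × Presentation, Computable f ∧
      (∀ x, (f x).1.IsTreeOfHeightLE n ∧ (f x).2.IsTreeOfHeightLE n) ∧
      ∀ x, B x ↔ (f x).1.Iso (f x).2 := by
  obtain ⟨R, hR, hBR⟩ := hB.exists_infQuant
  obtain ⟨f, hf, hfR⟩ := exists_presentations hR hn
  have hT : ComputablePred fun _ : ℕ × List ℕ => True :=
    computablePred_of_bool (fun _ => true) (Computable.const true) (by simp)
  obtain ⟨g, hg, hgT⟩ := exists_presentations hT hn
  refine ⟨fun x => (f x, g x), Computable.pair hf hg,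
    fun x => ⟨(hfR x).1, (hgT x).1⟩, fun x => ?_⟩
  obtain ⟨φ⟩ := (hfR x).2
  obtain ⟨ψ⟩ := (hgT x).2
  rw [hBR, ← nonempty_relIso_true_iff hn]
  exact ⟨fun ⟨e⟩ => ⟨(φ.trans e).trans ψ.symm⟩, fun ⟨e⟩ => ⟨(φ.symm.trans e).trans ψ⟩⟩

end Presenting

/-! ## Isomorphism of trees and matchings of children -/

section Matching

/-- Every list without repetitions of elements satisfying `p` is related by `r`, entry by entry,
to a list without repetitions of elements satisfying `q`. -/
def ListEmb {α β : Type} (p : α → Prop) (q : β → Prop) (r : α → β → Prop) : Prop :=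
  ∀ l : List α, (l.Nodup ∧ ∀ a ∈ l, p a) →
    ∃ l' : List β, (l'.Nodup ∧ ∀ b ∈ l', q b) ∧ List.Forall₂ r l l'

/-- Used to pass from lists of natural numbers, over which arithmetical formulas quantify, to lists
of children. -/
theorem listEmb_iff_of_range {α β A B : Type} {p : α → Prop} {q : β → Prop} {r : α → β → Prop}
    (ι : A → α) (κ : B → β) (hι : Function.Injective ι) (hκ : Function.Injective κ)
    (hp : ∀ a, p a ↔ a ∈ Set.range ι) (hq : ∀ b, q b ↔ b ∈ Set.range κ) :
    ListEmb p q r ↔ ∀ l : List A, l.Nodup → ∃ l' : List B, l'.Nodup ∧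
      List.Forall₂ (fun a b => r (ι a) (κ b)) l l' := by
  have lift : ∀ {γ C : Type} {s : γ → Prop} (j : C → γ), (∀ c, s c ↔ c ∈ Set.range j) →
      ∀ l : List γ, (∀ c ∈ l, s c) → ∃ l₀ : List C, l₀.map j = l := by
    intro γ C s j hs l hl
    have : l ∈ Set.range (List.map j) := by
      rw [Set.range_list_map]
      exact fun c hc => (hs c).1 (hl c hc)
    exact this
  constructor
  · intro h l hl
    obtain ⟨l', ⟨hl', hl'q⟩, hr⟩ := h (l.map ι) ⟨hl.map hι, fun a ha => by
      obtain ⟨b, -, rfl⟩ := List.mem_map.1 ha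
      exact (hp _).2 ⟨b, rfl⟩⟩
    obtain ⟨m, rfl⟩ := lift κ hq l' hl'q
    refine ⟨m, hl'.of_map κ, ?_⟩
    rwa [List.forall₂_map_left_iff, List.forall₂_map_right_iff] at hr
  · rintro h l ⟨hl, hlp⟩
    obtain ⟨m, rfl⟩ := lift ι hp l hlp
    obtain ⟨l', hl', hr⟩ := h m (hl.of_map ι)
    refine ⟨l'.map κ, ⟨hl'.map hκ, fun b hb => ?_⟩, ?_⟩
    · obtain ⟨c, -, rfl⟩ := List.mem_map.1 hb
      exact (hq _).2 ⟨c, rfl⟩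
    · rwa [List.forall₂_map_left_iff, List.forall₂_map_right_iff]

variable {V W : Type} {le : V → V → Prop} {le' : W → W → Prop}

/-- The order on the elements above `x`. -/
def coneLE (le : V → V → Prop) (x : V) (a b : {a // le x a}) : Prop := le a.1 b.1

/-- The subtrees above `x` and above `y` are isomorphic. -/
def ConeIso (le : V → V → Prop) (le' : W → W → Prop) (x : V) (y : W) : Prop :=
  Nonempty (coneLE le x ≃r coneLE le' y)

theorem ConeIso.refl (le : V → V → Prop) (x : V) : ConeIso le le x x := ⟨RelIso.refl _⟩

theorem ConeIso.symm {x : V} {y : W} : ConeIso le le' x y → ConeIso le' le y x :=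
  fun ⟨e⟩ => ⟨e.symm⟩

theorem ConeIso.trans {U : Type} {le'' : U → U → Prop} {x : V} {y : W} {z : U} :
    ConeIso le le' x y → ConeIso le' le'' y z → ConeIso le le'' x z :=
  fun ⟨e⟩ ⟨f⟩ => ⟨e.trans f⟩

/-- The upper covers of `x`. -/
abbrev Child (le : V → V → Prop) (x : V) : Type := {z // Covers le x z}

/-- The interval of elements above `x` and at most `w` is finite, so it has a minimal element. -/
theorem IsTree.exists_covers_le (h : IsTree le) {x w : V} (hxw : le x w) (hne : x ≠ w) :
    ∃ z, Covers le x z ∧ le z w := by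
  let _ : PartialOrder V :=
    { le := le
      le_refl := h.refl
      le_trans := h.trans
      le_antisymm := h.antisymm }
  have hfin : {z | le x z ∧ x ≠ z ∧ le z w}.Finite :=
    (h.finite_ancestors w).subset fun z hz => hz.2.2
  obtain ⟨z, ⟨hz1, hz2, hz3⟩, hmin⟩ := hfin.exists_minimal ⟨w, hxw, hne, h.refl w⟩
  refine ⟨z, ⟨hz1, hz2, fun u hxu huz => ?_⟩, hz3⟩
  by_cases hu : x = u
  · exact Or.inl hu.symm
  · exact Or.inr (h.antisymm _ _ huz (hmin ⟨hxu, hu, h.trans _ _ _ huz hz3⟩ huz))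

theorem IsTree.covers_unique (h : IsTree le) {x z z' w : V} (hz : Covers le x z)
    (hz' : Covers le x z') (hw : le z w) (hw' : le z' w) : z = z' := by
  rcases h.linear_ancestors w z z' hw hw' with hzz | hzz
  · exact (hz'.2.2 z hz.1 hzz).resolve_left hz.2.1.symm
  · exact ((hz.2.2 z' hz'.1 hzz).resolve_left hz'.2.1.symm).symm

/-- Every element strictly above `x` lies above exactly one cover of `x`: existence by finiteness,
uniqueness by linearity of the ancestors. -/
theorem IsTree.nonempty_relIso_join (h : IsTree le) (x : V) :
    Nonempty (coneLE le x ≃r Join fun z : Child le x => coneLE le z.1) := by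
  let f : Option (Σ z : Child le x, {a // le z.1 a}) → {a // le x a} := fun o =>
    match o with
    | none => ⟨x, h.refl x⟩
    | some ⟨z, a⟩ => ⟨a.1, h.trans _ _ _ z.2.1 a.2⟩
  have hnot : ∀ (z : Child le x) (a : {a // le z.1 a}), ¬ le a.1 x := fun z a ha =>
    z.2.2.1 (h.antisymm _ _ z.2.1 (h.trans _ _ _ a.2 ha))
  have hf : Function.Bijective f := by
    constructor
    · rintro (_ | ⟨z, a⟩) (_ | ⟨z', b⟩) heq
      · rfl
      · refine absurd ?_ (hnot z' b)
        have : x = b.1 := congrArg Subtype.val heq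
        rw [← this]
        exact h.refl x
      · refine absurd ?_ (hnot z a)
        have : a.1 = x := congrArg Subtype.val heq
        rw [this]
        exact h.refl x
      · have hab : a.1 = b.1 := congrArg Subtype.val heq
        have hz : z = z' := Subtype.ext (h.covers_unique z.2 z'.2 a.2 (hab ▸ b.2))
        subst hz
        rw [Subtype.ext hab]
    · rintro ⟨w, hw⟩
      by_cases hxw : x = w
      · exact ⟨none, Subtype.ext hxw⟩
      · obtain ⟨z, hz, hzw⟩ := h.exists_covers_le hw hxw
        exact ⟨some ⟨⟨z, hz⟩, w, hzw⟩, rfl⟩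
  refine ⟨RelIso.symm ⟨Equiv.ofBijective f hf, ?_⟩⟩
  rintro (_ | ⟨z, a⟩) (_ | ⟨z', b⟩)
  · exact iff_of_true (h.refl x) trivial
  · exact iff_of_true (h.trans _ _ _ z'.2.1 b.2) trivial
  · exact iff_of_false (hnot z a) id
  · change le a.1 b.1 ↔ _
    by_cases hz : z = z'
    · subst hz
      rw [join_some_iff]
      rfl
    · refine iff_of_false (fun hab => hz ?_) fun hj => hz hj.1
      exact Subtype.ext (h.covers_unique z.2 z'.2 (h.trans _ _ _ a.2 hab) b.2)

theorem ConeIso.of_children (h : IsTree le) (h' : IsTree le') {x : V} {y : W}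
    (e : Child le x ≃ Child le' y) (he : ∀ z, ConeIso le le' z.1 (e z).1) :
    ConeIso le le' x y := by
  obtain ⟨φ⟩ := h.nonempty_relIso_join x
  obtain ⟨ψ⟩ := h'.nonempty_relIso_join y
  obtain ⟨χ⟩ := Join.nonempty_relIso (r := fun z : Child le x => coneLE le z.1)
    (s := fun z : Child le' y => coneLE le' z.1) e he
  exact ⟨(φ.trans χ).trans ψ.symm⟩

/-- An isomorphism of cones fixes the roots, hence maps covers of the root to covers of the root and
restricts to the cones above them. -/
theorem ConeIso.exists_child_map (h : IsTree le) (h' : IsTree le') {x : V} {y : W}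
    (hxy : ConeIso le le' x y) :
    ∃ F : Child le x → Child le' y, Function.Injective F ∧ ∀ z, ConeIso le le' z.1 (F z).1 := by
  obtain ⟨e⟩ := hxy
  have hroot : e ⟨x, h.refl x⟩ = ⟨y, h'.refl y⟩ := by
    obtain ⟨w, hw⟩ := e.surjective ⟨y, h'.refl y⟩
    have h1 : coneLE le' y (e ⟨x, h.refl x⟩) (e w) := e.map_rel_iff.2 w.2
    rw [hw] at h1
    exact Subtype.ext (h'.antisymm _ _ h1 (e ⟨x, h.refl x⟩).2)
  let up : Child le x → {a // le x a} := fun z => ⟨z.1, z.2.1⟩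
  have hcov : ∀ z : Child le x, Covers le' y (e (up z)).1 := by
    intro z
    refine ⟨(e (up z)).2, fun heq => z.2.2.1 ?_, fun w hw hwz => ?_⟩
    · have : e ⟨x, h.refl x⟩ = e (up z) := by
        rw [hroot]
        exact Subtype.ext heq
      exact congrArg Subtype.val (e.injective this)
    · obtain ⟨v, hv⟩ := e.surjective ⟨w, hw⟩
      have hvz : le v.1 z.1 := (e.map_rel_iff (a := v) (b := up z)).1 (by rw [hv]; exact hwz)
      rcases z.2.2.2 v.1 v.2 hvz with h1 | h1
      · left
        have h2 : v = ⟨x, h.refl x⟩ := Subtype.ext h1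
        rw [h2, hroot] at hv
        exact (congrArg Subtype.val hv).symm
      · right
        have h2 : v = up z := Subtype.ext h1
        rw [h2] at hv
        exact (congrArg Subtype.val hv).symm
  refine ⟨fun z => ⟨_, hcov z⟩, fun z z' hzz => ?_, fun z => ?_⟩
  · have h1 : e (up z) = e (up z') := Subtype.ext (congrArg Subtype.val hzz :)
    exact Subtype.ext (congrArg Subtype.val (e.injective h1) :)
  · let g : {a // le z.1 a} → {a // le x a} := fun a => ⟨a.1, h.trans _ _ _ z.2.1 a.2⟩
    let f : {a // le z.1 a} → {a // le' (e (up z)).1 a} := fun a =>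
      ⟨(e (g a)).1, e.map_rel_iff.2 (show coneLE le x (up z) (g a) from a.2)⟩
    have hf : Function.Bijective f := by
      constructor
      · intro a b hab
        have h1 : e (g a) = e (g b) := Subtype.ext (congrArg Subtype.val hab :)
        exact Subtype.ext (congrArg Subtype.val (e.injective h1) :)
      · rintro ⟨w, hw⟩
        obtain ⟨v, hv⟩ := e.surjective ⟨w, h'.trans _ _ _ (e (up z)).2 hw⟩
        have hzv : le z.1 v.1 := (e.map_rel_iff (a := up z) (b := v)).1 (by rw [hv]; exact hw)
        refine ⟨⟨v.1, hzv⟩, Subtype.ext ?_⟩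
        exact (congrArg Subtype.val hv :)
    exact ⟨⟨Equiv.ofBijective f hf, fun {a b} => e.map_rel_iff (a := g a) (b := g b)⟩⟩

theorem ConeIso.exists_list (h : IsTree le) (h' : IsTree le') {x : V} {y : W}
    (hxy : ConeIso le le' x y) (l : List (Child le x)) (hl : l.Nodup) :
    ∃ l' : List (Child le' y), l'.Nodup ∧
      List.Forall₂ (fun a b => ConeIso le le' a.1 b.1) l l' := by
  obtain ⟨F, hF, hFi⟩ := hxy.exists_child_map h h'
  refine ⟨l.map F, hl.map hF, ?_⟩
  rw [List.forall₂_map_right_iff, List.forall₂_same]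
  exact fun z _ => hFi z

/-- The subtrees above two nodes are isomorphic if and only if finite families of children can be
matched in both directions. -/
theorem coneIso_iff_lists [Countable V] [Countable W] (h : IsTree le) (h' : IsTree le')
    {x : V} {y : W} :
    ConeIso le le' x y ↔
      (∀ l : List (Child le x), l.Nodup → ∃ l' : List (Child le' y), l'.Nodup ∧
        List.Forall₂ (fun a b => ConeIso le le' a.1 b.1) l l') ∧
      (∀ l : List (Child le' y), l.Nodup → ∃ l' : List (Child le x), l'.Nodup ∧
        List.Forall₂ (fun a b => ConeIso le' le a.1 b.1) l l') := by
  constructor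
  · exact fun hxy => ⟨hxy.exists_list h h', hxy.symm.exists_list h' h⟩
  · rintro ⟨h1, h2⟩
    -- The colour of a child is its isomorphism class, recorded by the nodes of both trees with the
    -- same cone, so that both colourings take values in one type.
    let f : Child le x → (V → Prop) × (W → Prop) := fun z =>
      (fun v => ConeIso le le z.1 v, fun w => ConeIso le le' z.1 w)
    let g : Child le' y → (V → Prop) × (W → Prop) := fun z =>
      (fun v => ConeIso le' le z.1 v, fun w => ConeIso le' le' z.1 w)
    have hfg : ∀ a b, f a = g b ↔ ConeIso le le' a.1 b.1 := by
      intro a b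
      constructor
      · intro hab
        exact (congrFun (congrArg Prod.snd hab) b.1).mpr (ConeIso.refl _ _)
      · intro hab
        refine Prod.ext (funext fun v => propext ?_) (funext fun w => propext ?_)
        · exact ⟨fun hv => hab.symm.trans hv, fun hv => hab.trans hv⟩
        · exact ⟨fun hv => hab.symm.trans hv, fun hv => hab.trans hv⟩
    obtain ⟨e, he⟩ := exists_equiv_of_fibers f g fun t => by
      refine le_antisymm (encard_fiber_le_of_lists f g ?_ t) (encard_fiber_le_of_lists g f ?_ t)
      · simpa only [hfg] using h1
      · intro l hl
        obtain ⟨l', hl', hr⟩ := h2 l hl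
        exact ⟨l', hl', hr.imp fun a b hab => ((hfg b a).2 hab.symm).symm⟩
    exact ConeIso.of_children h h' e fun z => (hfg _ _).1 (he z).symm

/-- Every chain starting at `x` has at most `k` further elements. -/
def Shallow (le : V → V → Prop) : ℕ → V → Prop
  | 0, x => ∀ z, le x z → x = z
  | k + 1, x => ∀ z, le x z → x ≠ z → Shallow le k z

/-! ### Levels and the depth of subtrees -/

theorem IsTree.level_lt (h : IsTree le) {x z : V} (hxz : le x z) (hne : x ≠ z) :
    level le x + 1 ≤ level le z := by
  unfold level
  rw [← Set.encard_insert_of_notMem (a := x) (by simp)]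
  refine Set.encard_le_encard ?_
  rintro y (rfl | ⟨hyx, hyne⟩)
  · exact ⟨hxz, hne⟩
  · refine ⟨h.trans _ _ _ hyx hxz, ?_⟩
    rintro rfl
    exact hne (h.antisymm _ _ hxz hyx)

/-- Each step up a chain raises the level by at least one, and no level exceeds `n`. -/
theorem IsTree.shallow (h : IsTree le) {n : ℕ} (hn : height le ≤ n) {k : ℕ} {x : V}
    (hk : (n : ℕ∞) ≤ level le x + k) : Shallow le k x := by
  have hlev : ∀ y, level le y ≤ n := fun y => (le_iSup (level le) y).trans hn
  induction k generalizing x with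
  | zero =>
    intro z hxz
    by_contra hne
    have h1 := h.level_lt hxz hne
    have h2 : (n : ℕ∞) + 1 ≤ n := by
      refine le_trans ?_ (h1.trans (hlev z))
      gcongr
      simpa using hk
    have h3 : n + 1 ≤ n := by exact_mod_cast h2
    omega
  | succ k ih =>
    intro z hxz hne
    refine ih (hk.trans ?_)
    have h1 := h.level_lt hxz hne
    calc level le x + ((k + 1 : ℕ) : ℕ∞) = level le x + 1 + k := by push_cast; ring
      _ ≤ level le z + k := by gcongr

theorem ConeIso.of_shallow_zero (h : IsTree le) (h' : IsTree le') {x : V} {y : W}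
    (hx : Shallow le 0 x) (hy : Shallow le' 0 y) : ConeIso le le' x y := by
  have hc : ∀ z, ¬ Covers le x z := fun z hz => hz.2.1 (hx z hz.1)
  have hc' : ∀ z, ¬ Covers le' y z := fun z hz => hz.2.1 (hy z hz.1)
  have : IsEmpty (Child le x) := ⟨fun z => hc z.1 z.2⟩
  have : IsEmpty (Child le' y) := ⟨fun z => hc' z.1 z.2⟩
  exact ConeIso.of_children h h' (Equiv.equivOfIsEmpty _ _) fun z => isEmptyElim z

/-- There is no room for intermediate elements, so the minimality clause of `Covers`, which costs a
universal quantifier, can be dropped. -/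
theorem Shallow.covers_iff {x z : V} (hx : Shallow le 1 x) :
    Covers le x z ↔ le x z ∧ x ≠ z := by
  refine ⟨fun hz => ⟨hz.1, hz.2.1⟩, fun hz => ⟨hz.1, hz.2, fun u hxu huz => ?_⟩⟩
  by_cases hu : x = u
  · exact Or.inl hu.symm
  · exact Or.inr (hx u hxu hu z huz)

theorem nonempty_relIso_iff_coneIso {r : V} {s : W} (hr : ∀ x, le r x) (hs : ∀ y, le' s y) :
    Nonempty (le ≃r le') ↔ ConeIso le le' r s := by
  have φ : le ≃r coneLE le r := ⟨(Equiv.subtypeUnivEquiv hr).symm, Iff.rfl⟩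
  have ψ : le' ≃r coneLE le' s := ⟨(Equiv.subtypeUnivEquiv hs).symm, Iff.rfl⟩
  exact ⟨fun ⟨e⟩ => ⟨(φ.symm.trans e).trans ψ⟩, fun ⟨e⟩ => ⟨(φ.trans e).trans ψ.symm⟩⟩

end Matching

/-! ## The isomorphism problem is in `Π⁰_{2n}` -/

section UpperBound

/-- The relation decided by the second program, on natural numbers. -/
def natLE (P : Presentation) (x y : ℕ) : Prop := Accepts P.2 (Nat.pair x y)

/-- `z` lies above `x`, and covers it unless `k = 0`. -/
def ChildOf (k : ℕ) (u : Presentation × ℕ) (z : ℕ) : Prop :=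
  natLE u.1 u.2 z ∧ u.2 ≠ z ∧
    -- Omitting the `Π⁰_1` covering condition at `k = 0` keeps the bottom level `Σ⁰_1`, as the bound
    -- `Π⁰_2` for height 1 requires.
    (k = 0 ∨ ∀ w, (natLE u.1 u.2 w ∧ natLE u.1 w z) → w = u.2 ∨ w = z)

/-- An arithmetical description of the isomorphism of subtrees of height at most `k`. -/
def ArithIso : ℕ → (Presentation × ℕ) × (Presentation × ℕ) → Prop
  | 0, _ => True
  | k + 1, x =>
    ListEmb (ChildOf k x.1) (ChildOf k x.2) (fun a b => ArithIso k ((x.1.1, a), (x.2.1, b))) ∧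
    ListEmb (ChildOf k x.2) (ChildOf k x.1) (fun a b => ArithIso k ((x.2.1, a), (x.1.1, b)))

theorem Presentation.IsValid.covers_iff {P : Presentation} (hP : P.IsValid) {k : ℕ} {a : P.Dom}
    (ha : Shallow P.rel (k + 1) a) (z : ℕ) :
    ChildOf k (P, a.1) z ↔ z ∈ Set.range fun b : Child P.rel a => b.1.1 := by
  have hdom : natLE P a.1 z → Accepts P.1 z := fun h => (hP.rel_subset _ _ h).2
  have hcov : ∀ b : P.Dom, ChildOf k (P, a.1) b.1 ↔ Covers P.rel a b := by
    intro b
    have hne : a.1 ≠ b.1 ↔ a ≠ b := not_congr Subtype.ext_iff.symm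
    rcases Nat.eq_zero_or_pos k with rfl | hk
    · rw [Shallow.covers_iff ha, ← hne]
      simp only [ChildOf, true_or, and_true]
      exact Iff.rfl
    · unfold ChildOf Covers
      rw [← hne]
      refine and_congr_right fun _ => and_congr_right fun _ => ?_
      constructor
      · intro h w hw hwb
        exact (h.resolve_left hk.ne' w.1 ⟨hw, hwb⟩).imp Subtype.ext Subtype.ext
      · refine fun h => Or.inr fun w hw => ?_
        exact (h ⟨w, (hP.rel_subset _ _ hw.1).2⟩ hw.1 hw.2).imp
          (fun e => (congrArg Subtype.val e :)) fun e => (congrArg Subtype.val e :)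
  constructor
  · intro h
    exact ⟨⟨⟨z, hdom h.1⟩, (hcov ⟨z, hdom h.1⟩).1 h⟩, rfl⟩
  · rintro ⟨b, rfl⟩
    exact (hcov b.1).2 b.2

instance (P : Presentation) : Countable P.Dom :=
  inferInstanceAs (Countable {x : ℕ // Accepts P.1 x})

theorem child_val_injective {P : Presentation} {a : P.Dom} :
    Function.Injective fun b : Child P.rel a => b.1.1 :=
  fun _ _ h => Subtype.ext (Subtype.ext h)

/-- Induction along `coneIso_iff_lists`. The presentations stay universally quantified because the
second half of the matching exchanges them. -/
theorem arithIso_iff {k : ℕ} : ∀ {P Q : Presentation}, P.IsValid → Q.IsValid → IsTree P.rel →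
    IsTree Q.rel → ∀ {a : P.Dom} {b : Q.Dom}, Shallow P.rel k a → Shallow Q.rel k b →
    (ArithIso k ((P, a.1), (Q, b.1)) ↔ ConeIso P.rel Q.rel a b) := by
  induction k with
  | zero =>
    intro P Q _ _ tP tQ a b ha hb
    exact iff_of_true trivial (ConeIso.of_shallow_zero tP tQ ha hb)
  | succ k ih =>
    have half : ∀ {P Q : Presentation}, P.IsValid → Q.IsValid → IsTree P.rel →
        IsTree Q.rel → ∀ {a : P.Dom} {b : Q.Dom}, Shallow P.rel (k + 1) a →
        Shallow Q.rel (k + 1) b →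
        (ListEmb (ChildOf k (P, a.1)) (ChildOf k (Q, b.1))
          (fun x y => ArithIso k ((P, x), (Q, y))) ↔
        ∀ l : List (Child P.rel a), l.Nodup → ∃ l' : List (Child Q.rel b), l'.Nodup ∧
          List.Forall₂ (fun x y => ConeIso P.rel Q.rel x.1 y.1) l l') := by
      intro P Q hP hQ tP tQ a b ha hb
      rw [listEmb_iff_of_range (fun x : Child P.rel a => x.1.1) (fun y : Child Q.rel b => y.1.1)
        child_val_injective child_val_injective (hP.covers_iff ha) (hQ.covers_iff hb)]
      have hr : ∀ (x : Child P.rel a) (y : Child Q.rel b),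
          ArithIso k ((P, x.1.1), (Q, y.1.1)) ↔ ConeIso P.rel Q.rel x.1 y.1 := fun x y =>
        ih hP hQ tP tQ (ha x.1 x.2.1 x.2.2.1) (hb y.1 y.2.1 y.2.2.1)
      simp only [hr]
    intro P Q hP hQ tP tQ a b ha hb
    rw [coneIso_iff_lists tP tQ, ← half hP hQ tP tQ ha hb, ← half hQ hP tQ tP hb ha]
    rfl

/-- `r` is a minimal element. -/
def IsMin (P : Presentation) (r : ℕ) : Prop := Accepts P.1 r ∧ ∀ w, natLE P w r → w = r

/-- The roots are the only minimal elements, so a universal quantifier over minimal elements names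
them without leaving the `Π` side. -/
theorem iso_iff_arithIso {n : ℕ} {P Q : Presentation} (hP : P.IsTreeOfHeightLE n)
    (hQ : Q.IsTreeOfHeightLE n) :
    P.Iso Q ↔ ∀ r s, (IsMin P r ∧ IsMin Q s) → ArithIso n ((P, r), (Q, s)) := by
  have hmin : ∀ {P : Presentation}, P.IsTreeOfHeightLE n → ∃ r : P.Dom, (∀ x, P.rel r x) ∧
      Shallow P.rel n r ∧ ∀ m, IsMin P m ↔ m = r.1 := by
    intro P hP
    obtain ⟨r, hr⟩ := hP.2.1.exists_root
    refine ⟨r, hr, hP.2.1.shallow hP.2.2 le_add_self, fun m => ⟨fun hm => ?_, ?_⟩⟩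
    · exact (hm.2 r.1 (hr ⟨m, hm.1⟩)).symm
    · rintro rfl
      refine ⟨r.2, fun w hw => ?_⟩
      have hw' : Accepts P.1 w := (hP.1.rel_subset _ _ hw).1
      exact (congrArg Subtype.val (hP.2.1.antisymm ⟨w, hw'⟩ r hw (hr _)) :)
  obtain ⟨r, hr, hrn, hrm⟩ := hmin hP
  obtain ⟨s, hs, hsn, hsm⟩ := hmin hQ
  unfold Presentation.Iso
  rw [nonempty_relIso_iff_coneIso hr hs, ← arithIso_iff hP.1 hQ.1 hP.2.1 hQ.2.1 hrn hsn]
  simp [hrm, hsm]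

/-- An arithmetical description of the recursive trees of height at most `n`. -/
def ArithTree (n : ℕ) (P : Presentation) : Prop :=
  (∀ x, Accepts P.1 x ∨ Rejects P.1 x) ∧ (∀ x, Accepts P.2 x ∨ Rejects P.2 x) ∧
  (∀ a b, natLE P a b → Accepts P.1 a ∧ Accepts P.1 b) ∧
  (∀ a, Accepts P.1 a → natLE P a a) ∧
  (∀ a b, (natLE P a b ∧ natLE P b a) → a = b) ∧
  (∀ a b c, (natLE P a b ∧ natLE P b c) → natLE P a c) ∧
  (∃ a, Accepts P.1 a) ∧
  -- A least element would cost an ∃∀ block; common lower bounds need only ∀∃ and suffice when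
  -- ancestors are finite.
  (∀ a b, (Accepts P.1 a ∧ Accepts P.1 b) → ∃ c, natLE P c a ∧ natLE P c b) ∧
  (∀ a b c, (natLE P b a ∧ natLE P c a) → natLE P b c ∨ natLE P c b) ∧
  ∀ a, ∀ l : List ℕ, (l.Nodup ∧ l.length = n + 1) → ¬ ∀ b ∈ l, natLE P b a ∧ b ≠ a

theorem encard_le_iff_lists {V : Type} {s : Set V} {n : ℕ} :
    s.encard ≤ n ↔ ∀ l : List V, (l.Nodup ∧ l.length = n + 1) → ¬ ∀ b ∈ l, b ∈ s := by
  classical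
  constructor
  · rintro h l ⟨hl, hlen⟩ hls
    have h1 : (l.toFinset : Set V) ⊆ s := fun b hb => hls b (by simpa using hb)
    have h2 := (Set.encard_le_encard h1).trans h
    rw [Set.encard_coe_eq_coe_finsetCard, List.toFinset_card_of_nodup hl, hlen] at h2
    have h3 : n + 1 ≤ n := by exact_mod_cast h2
    omega
  · intro h
    by_contra hn
    have h1 : ((n + 1 : ℕ) : ℕ∞) ≤ s.encard := by
      push_cast
      exact Order.add_one_le_of_lt (not_le.1 hn)
    obtain ⟨t, hts, htn⟩ := Set.exists_subset_encard_eq h1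
    have hfin : t.Finite := Set.finite_of_encard_eq_coe htn
    refine h hfin.toFinset.toList ⟨Finset.nodup_toList _, ?_⟩ fun b hb => hts (by simpa using hb)
    rw [Finset.length_toList]
    have : ((hfin.toFinset.card : ℕ) : ℕ∞) = ((n + 1 : ℕ) : ℕ∞) := by
      rw [← htn, ← Set.encard_coe_eq_coe_finsetCard, hfin.coe_toFinset]
    exact_mod_cast this

theorem isTreeOfHeightLE_iff {n : ℕ} {P : Presentation} :
    P.IsTreeOfHeightLE n ↔ ArithTree n P := by
  have hlists : ∀ (_ : P.IsValid) (a : P.Dom), level P.rel a ≤ n ↔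
      ∀ l : List ℕ, (l.Nodup ∧ l.length = n + 1) → ¬ ∀ b ∈ l, natLE P b a.1 ∧ b ≠ a.1 := by
    intro hP a
    have himg : (fun b : P.Dom => b.1) '' {y | P.rel y a ∧ y ≠ a} =
        {b | natLE P b a.1 ∧ b ≠ a.1} := by
      ext b
      constructor
      · rintro ⟨y, ⟨h1, h2⟩, rfl⟩
        exact ⟨h1, fun h => h2 (Subtype.ext h)⟩
      · rintro ⟨h1, h2⟩
        exact ⟨⟨b, (hP.rel_subset _ _ h1).1⟩, ⟨h1, fun h => h2 (congrArg Subtype.val h :)⟩, rfl⟩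
    have hinj : Function.Injective fun b : P.Dom => b.1 := Subtype.val_injective
    rw [level, ← hinj.encard_image, himg, encard_le_iff_lists]
    rfl
  constructor
  · rintro ⟨hv, ht, hh⟩
    have hlev : ∀ x, level P.rel x ≤ n := fun x => (le_iSup (level P.rel) x).trans hh
    have hd := hv.rel_subset
    obtain ⟨r, hr⟩ := ht.exists_root
    refine ⟨hv.decides_dom, hv.decides_rel, hd, fun a ha => ht.refl ⟨a, ha⟩, ?_, ?_, ⟨r.1, r.2⟩,
      ?_, ?_, fun a l hl => ?_⟩
    · rintro a b ⟨h1, h2⟩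
      exact (congrArg Subtype.val (ht.antisymm ⟨a, (hd _ _ h1).1⟩ ⟨b, (hd _ _ h1).2⟩ h1 h2) :)
    · rintro a b c ⟨h1, h2⟩
      exact ht.trans ⟨a, (hd _ _ h1).1⟩ ⟨b, (hd _ _ h1).2⟩ ⟨c, (hd _ _ h2).2⟩ h1 h2
    · rintro a b ⟨ha, hb⟩
      exact ⟨r.1, hr ⟨a, ha⟩, hr ⟨b, hb⟩⟩
    · rintro a b c ⟨h1, h2⟩
      exact ht.linear_ancestors ⟨a, (hd _ _ h1).2⟩ ⟨b, (hd _ _ h1).1⟩ ⟨c, (hd _ _ h2).1⟩ h1 h2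
    · intro hall
      -- Here `a` is not known to lie in the domain; since the list has `n + 1 > 0` entries, its
      -- first entry shows that it does.
      cases l with
      | nil => simp at hl
      | cons b l =>
        have ha : Accepts P.1 a := (hd _ _ (hall b List.mem_cons_self).1).2
        exact (hlists hv ⟨a, ha⟩).1 (hlev _) _ hl hall
  · rintro ⟨h1, h2, hd, hrefl, hanti, htrans, ⟨a₀, ha₀⟩, hmeet, hlin, hlen⟩
    have hv : P.IsValid := ⟨h1, h2, hd⟩
    have hlev : ∀ x, level P.rel x ≤ n := fun x => (hlists hv x).2 (hlen x.1)
    have hfin : ∀ x, {y | P.rel y x}.Finite := by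
      intro x
      have hfin' : {y | P.rel y x ∧ y ≠ x}.Finite :=
        Set.finite_of_encard_le_coe (hlev x)
      refine (hfin'.insert x).subset fun y hy => ?_
      by_cases hyx : y = x
      · exact Or.inl hyx
      · exact Or.inr ⟨hy, hyx⟩
    have hanti' : ∀ x y : P.Dom, P.rel x y → P.rel y x → x = y := fun x y hxy hyx =>
      Subtype.ext (hanti _ _ ⟨hxy, hyx⟩)
    have htrans' : ∀ x y z : P.Dom, P.rel x y → P.rel y z → P.rel x z := fun x y z hxy hyz =>
      htrans _ _ _ ⟨hxy, hyz⟩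
    refine ⟨hv, ⟨fun x => hrefl x.1 x.2, hanti', htrans', ?_, hfin,
      fun x y z hy hz => hlin _ _ _ ⟨hy, hz⟩⟩, iSup_le hlev⟩
    let _ : PartialOrder P.Dom :=
      { le := P.rel
        le_refl := fun x => hrefl x.1 x.2
        le_trans := htrans'
        le_antisymm := hanti' }
    -- A minimal ancestor `m` of any element is least: a common lower bound of `m` and `x` lies
    -- below `m`, so by minimality `m` lies below it and hence below `x`.
    obtain ⟨m, hm, hmin⟩ := (hfin ⟨a₀, ha₀⟩).exists_minimal ⟨⟨a₀, ha₀⟩, hrefl a₀ ha₀⟩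
    refine ⟨m, fun x => ?_⟩
    obtain ⟨c, hcm, hcx⟩ := hmeet m.1 x.1 ⟨m.2, x.2⟩
    have hc : Accepts P.1 c := (hd _ _ hcm).1
    have hmc : P.rel m ⟨c, hc⟩ := hmin (htrans' ⟨c, hc⟩ m ⟨a₀, ha₀⟩ hcm hm) hcm
    exact htrans' m ⟨c, hc⟩ x hmc hcx

end UpperBound

/-! ## Complexity of the arithmetical descriptions -/

section Complexity

variable {α : Type} [Primcodable α]

/-- Halting with a given output is witnessed by a bound for the decidable bounded evaluation. -/
theorem isSigma0_eval_eq (m : ℕ) {c : α → Code} {x : α → ℕ} (hc : Computable c)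
    (hx : Computable x) : IsSigma0 1 fun a => (c a).eval (x a) = Part.some m := by
  have h : ComputablePred fun y : α × ℕ => Code.evaln y.2 (c y.1) (x y.1) = some m := by
    refine ComputablePred.comp' (p := fun z : Option ℕ × Option ℕ => z.1 = z.2)
      Primrec.eq.computablePred (Computable.pair ?_ (Computable.const (some m)))
    exact Code.primrec_evaln.to_comp.comp (Computable.pair
      (Computable.pair Computable.snd (hc.comp Computable.fst)) (hx.comp Computable.fst))
  refine IsSigma0.of_iff (IsSigma0.exists_nat (k := 0)
    (p := fun a s => Code.evaln s (c a) (x a) = some m) (h.sigma 1)) fun a => ?_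
  rw [Part.eq_some_iff, Code.evaln_complete]
  rfl

theorem isSigma0_accepts {c : α → Code} {x : α → ℕ} (hc : Computable c) (hx : Computable x) :
    IsSigma0 1 fun a => Accepts (c a) (x a) :=
  isSigma0_eval_eq 1 hc hx

theorem isSigma0_natLE {P : α → Presentation} {x y : α → ℕ} (hP : Computable P)
    (hx : Computable x) (hy : Computable y) : IsSigma0 1 fun a => natLE (P a) (x a) (y a) :=
  isSigma0_accepts (Computable.snd.comp hP) (Primrec₂.natPair.to_comp.comp hx hy)

theorem computablePred_eq {β : Type} [Primcodable β] {f g : α → β} (hf : Computable f)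
    (hg : Computable g) : ComputablePred fun a => f a = g a := by
  classical
  exact ComputablePred.comp' (p := fun z : β × β => z.1 = z.2)
    Primrec.eq.computablePred (Computable.pair hf hg)

theorem IsSigma0.forall_mem {k : ℕ} {p : α → ℕ → Prop}
    (hp : IsSigma0 k fun x : α × ℕ => p x.1 x.2) {l : α → List ℕ} (hl : Computable l) :
    IsSigma0 k fun a => ∀ b ∈ l a, p a b := by
  refine IsSigma0.of_iff (IsSigma0.forall_lt (p := fun a i => p a ((l a).getD i 0))
    (hp.comp (f := fun x : α × ℕ => (x.1, (l x.1).getD x.2 0)) (Computable.pair Computable.fst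
      (computable_getD.comp (hl.comp Computable.fst) Computable.snd)))
    (Computable.list_length.comp hl)) fun a => ?_
  constructor
  · intro h i hi
    rw [List.getD_eq_getElem _ _ hi]
    exact h _ (List.getElem_mem hi)
  · intro h b hb
    obtain ⟨i, hi, rfl⟩ := List.getElem_of_mem hb
    have := h i hi
    rwa [List.getD_eq_getElem _ _ hi] at this

theorem IsSigma0.forall₂ {k : ℕ} {r : α → ℕ → ℕ → Prop}
    (hr : IsSigma0 k fun x : α × ℕ × ℕ => r x.1 x.2.1 x.2.2) {l l' : α → List ℕ}
    (hl : Computable l) (hl' : Computable l') :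
    IsSigma0 k fun a => List.Forall₂ (r a) (l a) (l' a) := by
  refine IsSigma0.of_iff (IsSigma0.and
    ((computablePred_eq (Computable.list_length.comp hl) (Computable.list_length.comp hl')).sigma k)
    (IsSigma0.forall_lt (p := fun a i => r a ((l a).getD i 0) ((l' a).getD i 0))
    (hr.comp (f := fun x : α × ℕ => (x.1, (l x.1).getD x.2 0, (l' x.1).getD x.2 0))
      (Computable.pair Computable.fst (Computable.pair
        (computable_getD.comp (hl.comp Computable.fst) Computable.snd)
        (computable_getD.comp (hl'.comp Computable.fst) Computable.snd))))
    (Computable.list_length.comp hl))) fun a => ?_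
  rw [List.forall₂_iff_get]
  refine and_congr_right fun hlen => ⟨fun h i hi => ?_, fun h i hi hi' => ?_⟩
  · rw [List.getD_eq_getElem _ _ hi, List.getD_eq_getElem _ _ (hlen ▸ hi)]
    exact h i hi (hlen ▸ hi)
  · have := h i hi
    rwa [List.getD_eq_getElem _ _ hi, List.getD_eq_getElem _ _ hi'] at this

theorem computablePred_nodup {l : α → List ℕ} (hl : Computable l) :
    ComputablePred fun a => (l a).Nodup := by
  have hlen : Computable fun a => (l a).length := Computable.list_length.comp hl
  have h : IsSigma0 0 fun x : (α × ℕ) × ℕ => (l x.1.1).getD x.1.2 0 = (l x.1.1).getD x.2 0 →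
      x.1.2 = x.2 := by
    have c1 : Computable fun x : (α × ℕ) × ℕ => l x.1.1 :=
      hl.comp (Computable.fst.comp Computable.fst)
    have c2 : Computable fun x : (α × ℕ) × ℕ => x.1.2 := Computable.snd.comp Computable.fst
    have h1 : ComputablePred fun x : (α × ℕ) × ℕ =>
        (l x.1.1).getD x.1.2 0 = (l x.1.1).getD x.2 0 :=
      computablePred_eq (computable_getD.comp c1 c2) (computable_getD.comp c1 Computable.snd)
    have h2 : ComputablePred fun x : (α × ℕ) × ℕ => x.1.2 = x.2 :=
      computablePred_eq c2 Computable.snd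
    exact IsSigma0.of_iff (IsSigma0.or (k := 0) h1.not h2) fun x => by tauto
  have h3 := IsSigma0.forall_lt (p := fun (x : α × ℕ) j =>
    (l x.1).getD x.2 0 = (l x.1).getD j 0 → x.2 = j) h (hlen.comp Computable.fst)
  have h4 := IsSigma0.forall_lt (p := fun a i => ∀ j < (l a).length,
    (l a).getD i 0 = (l a).getD j 0 → i = j) h3 hlen
  refine IsSigma0.of_iff (k := 0) h4 fun a => ?_
  constructor
  · intro hn i hi j hj hij
    rw [List.getD_eq_getElem _ _ hi, List.getD_eq_getElem _ _ hj] at hij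
    exact (hn.getElem_inj_iff).1 hij
  · intro hn
    refine List.nodup_iff_injective_get.2 fun i j hij => Fin.ext (hn i i.2 j j.2 ?_)
    rw [List.getD_eq_getElem _ _ i.2, List.getD_eq_getElem _ _ j.2]
    exact hij

/-- This is the cost of one level: the quantifiers over list entries are bounded and cost nothing,
leaving one universal and one existential quantifier over lists, the latter absorbed by `Σ⁰_{k+1}`.
-/
theorem isPi0_listEmb {k : ℕ} {p q : α → ℕ → Prop} {r : α → ℕ → ℕ → Prop}
    (hp : IsSigma0 (k + 1) fun x : α × ℕ => p x.1 x.2)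
    (hq : IsSigma0 (k + 1) fun x : α × ℕ => q x.1 x.2)
    (hr : IsSigma0 (k + 1) fun x : α × ℕ × ℕ => r x.1 x.2.1 x.2.2) :
    IsPi0 (k + 2) fun a => ListEmb (p a) (q a) (r a) := by
  have side : ∀ {s : α → ℕ → Prop}, IsSigma0 (k + 1) (fun x : α × ℕ => s x.1 x.2) →
      ∀ {β : Type} [Primcodable β] {f : β → α} {l : β → List ℕ}, Computable f → Computable l →
      IsSigma0 (k + 1) fun b => (l b).Nodup ∧ ∀ c ∈ l b, s (f b) c := by
    intro s hs β _ f l hf hl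
    exact IsSigma0.and ((computablePred_nodup hl).sigma _)
      (IsSigma0.forall_mem (p := fun b c => s (f b) c)
        (hs.comp (Computable.pair (hf.comp Computable.fst) Computable.snd)) hl)
  refine IsPi0.forall (p := fun a (l : List ℕ) => (l.Nodup ∧ ∀ b ∈ l, p a b) →
    ∃ l' : List ℕ, (l'.Nodup ∧ ∀ b ∈ l', q a b) ∧ List.Forall₂ (r a) l l') (IsPi0.imp ?_ ?_)
  · exact (side hp Computable.fst Computable.snd).succ
  · refine IsSigma0.pi_succ (IsSigma0.exists (p := fun (x : α × List ℕ) (l' : List ℕ) =>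
      (l'.Nodup ∧ ∀ b ∈ l', q x.1 b) ∧ List.Forall₂ (r x.1) x.2 l') (IsSigma0.and ?_ ?_))
    · exact side hq (Computable.fst.comp Computable.fst) Computable.snd
    · refine IsSigma0.forall₂ (r := fun (x : (α × List ℕ) × List ℕ) b c => r x.1.1 b c) ?_
        (Computable.snd.comp Computable.fst) Computable.snd
      exact hr.comp (f := fun x : ((α × List ℕ) × List ℕ) × ℕ × ℕ => (x.1.1.1, x.2))
        (Computable.pair (Computable.fst.comp (Computable.fst.comp Computable.fst)) Computable.snd)

/-- For `k > 0` the `Π⁰_1` covering condition fits into `Σ⁰_{2k+1}`, the class in which `ArithIso k`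
is used at the next level. -/
theorem isSigma0_childOf (k : ℕ) :
    IsSigma0 (2 * k + 1) fun x : (Presentation × ℕ) × ℕ => ChildOf k x.1 x.2 := by
  have cP : Computable fun x : (Presentation × ℕ) × ℕ => x.1.1 :=
    Computable.fst.comp Computable.fst
  have cx : Computable fun x : (Presentation × ℕ) × ℕ => x.1.2 :=
    Computable.snd.comp Computable.fst
  refine IsSigma0.and ((isSigma0_natLE cP cx Computable.snd).mono (by omega))
    (IsSigma0.and ((computablePred_eq cx Computable.snd).not.sigma _) ?_)
  rcases Nat.eq_zero_or_pos k with rfl | hk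
  · exact IsSigma0.of_iff (p := fun _ => True)
      ((computablePred_of_bool (fun _ => true) (Computable.const true) (by simp)).sigma _)
      fun x => by simp
  · have h : IsPi0 1 fun x : (Presentation × ℕ) × ℕ => ∀ w,
        (natLE x.1.1 x.1.2 w ∧ natLE x.1.1 w x.2) → w = x.1.2 ∨ w = x.2 := by
      refine IsPi0.forall (k := 0) (p := fun (x : (Presentation × ℕ) × ℕ) w =>
        (natLE x.1.1 x.1.2 w ∧ natLE x.1.1 w x.2) → w = x.1.2 ∨ w = x.2) (IsPi0.imp ?_ ?_)
      · exact IsSigma0.and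
          (isSigma0_natLE (cP.comp Computable.fst) (cx.comp Computable.fst) Computable.snd)
          (isSigma0_natLE (cP.comp Computable.fst) Computable.snd
            (Computable.snd.comp Computable.fst))
      · exact IsPi0.or ((computablePred_eq Computable.snd (cx.comp Computable.fst)).pi _)
          ((computablePred_eq Computable.snd (Computable.snd.comp Computable.fst)).pi _)
    exact IsSigma0.of_iff (h.sigma_of_lt (by omega)) fun x => by simp [hk.ne']

theorem isPi0_arithIso (k : ℕ) : IsPi0 (2 * k) (ArithIso k) := by
  induction k with
  | zero =>
    exact (computablePred_of_bool (fun _ => true) (Computable.const true)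
      (by simp [ArithIso])).pi _
  | succ k ih =>
    have half : ∀ {u v : (Presentation × ℕ) × (Presentation × ℕ) → Presentation × ℕ},
        Computable u → Computable v → IsPi0 (2 * k + 2) fun x =>
          ListEmb (ChildOf k (u x)) (ChildOf k (v x))
            fun a b => ArithIso k (((u x).1, a), ((v x).1, b)) := by
      intro u v hu hv
      refine isPi0_listEmb
        (p := fun x => ChildOf k (u x)) (q := fun x => ChildOf k (v x))
        (r := fun x a b => ArithIso k (((u x).1, a), ((v x).1, b))) ?_ ?_ ?_
      · exact (isSigma0_childOf k).comp
          (Computable.pair (hu.comp Computable.fst) Computable.snd)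
      · exact (isSigma0_childOf k).comp
          (Computable.pair (hv.comp Computable.fst) Computable.snd)
      · refine ih.sigma_succ.comp (Computable.pair (Computable.pair
          (Computable.fst.comp (hu.comp Computable.fst)) (Computable.fst.comp Computable.snd))
          (Computable.pair (Computable.fst.comp (hv.comp Computable.fst))
            (Computable.snd.comp Computable.snd)))
    exact IsPi0.and (half Computable.fst Computable.snd) (half Computable.snd Computable.fst)

/-- Acceptance is only `Σ⁰_1` for arbitrary programs, so every clause is counted without assuming
that they decide anything. -/
theorem isPi0_arithTree (n : ℕ) : IsPi0 2 (ArithTree n) := by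
  have f1 {β γ : Type} [Primcodable β] [Primcodable γ] : Computable (Prod.fst : β × γ → β) :=
    Computable.fst
  have f2 {β γ : Type} [Primcodable β] [Primcodable γ] : Computable (Prod.snd : β × γ → γ) :=
    Computable.snd
  have decider : ∀ {c : Presentation → Code}, Computable c →
      IsPi0 2 fun P => ∀ x, Accepts (c P) x ∨ Rejects (c P) x := by
    intro c hc
    refine IsPi0.forall (k := 1) (p := fun P x => Accepts (c P) x ∨ Rejects (c P) x)
      (IsSigma0.pi_succ (IsSigma0.or ?_ ?_))
    · exact isSigma0_eval_eq 1 (hc.comp f1) f2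
    · exact isSigma0_eval_eq 0 (hc.comp f1) f2
  have dom : ∀ {β : Type} [Primcodable β] {P : β → Presentation} {x : β → ℕ}, Computable P →
      Computable x → IsSigma0 1 fun b => Accepts (P b).1 (x b) := fun hP hx =>
    isSigma0_accepts (f1.comp hP) hx
  refine IsPi0.and (decider f1) (IsPi0.and (decider f2) (IsPi0.and ?_ (IsPi0.and ?_ (IsPi0.and ?_
    (IsPi0.and ?_ (IsPi0.and ?_ (IsPi0.and ?_ (IsPi0.and ?_ ?_))))))))
  · refine IsPi0.forall (k := 1) (p := fun (P : Presentation) a => ∀ b, natLE P a b →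
      Accepts P.1 a ∧ Accepts P.1 b) (IsPi0.forall (k := 1)
      (p := fun (x : Presentation × ℕ) b => natLE x.1 x.2 b →
        Accepts x.1.1 x.2 ∧ Accepts x.1.1 b) (IsPi0.imp ?_ (IsSigma0.pi_succ (IsSigma0.and ?_ ?_))))
    · exact (isSigma0_natLE (f1.comp f1) (f2.comp f1) f2).succ
    · exact dom (f1.comp f1) (f2.comp f1)
    · exact dom (f1.comp f1) f2
  · refine IsPi0.forall (k := 1) (p := fun (P : Presentation) a => Accepts P.1 a → natLE P a a)
      (IsPi0.imp ?_ (IsSigma0.pi_succ ?_))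
    · exact (dom f1 f2).succ
    · exact isSigma0_natLE f1 f2 f2
  · refine IsPi0.forall (k := 1) (p := fun (P : Presentation) a => ∀ b, (natLE P a b ∧
      natLE P b a) → a = b) (IsPi0.forall (k := 1) (p := fun (x : Presentation × ℕ) b =>
      (natLE x.1 x.2 b ∧ natLE x.1 b x.2) → x.2 = b) (IsPi0.imp (IsSigma0.succ
        (IsSigma0.and ?_ ?_)) ?_))
    · exact isSigma0_natLE (f1.comp f1) (f2.comp f1) f2
    · exact isSigma0_natLE (f1.comp f1) f2 (f2.comp f1)
    · exact (computablePred_eq (f2.comp f1) f2).pi _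
  · refine IsPi0.forall (k := 1) (p := fun (P : Presentation) a => ∀ b c, (natLE P a b ∧
      natLE P b c) → natLE P a c) (IsPi0.forall (k := 1) (p := fun (x : Presentation × ℕ) b =>
      ∀ c, (natLE x.1 x.2 b ∧ natLE x.1 b c) → natLE x.1 x.2 c) (IsPi0.forall (k := 1)
      (p := fun (x : (Presentation × ℕ) × ℕ) c => (natLE x.1.1 x.1.2 x.2 ∧ natLE x.1.1 x.2 c) →
        natLE x.1.1 x.1.2 c) (IsPi0.imp (IsSigma0.succ (IsSigma0.and ?_ ?_))
          (IsSigma0.pi_succ ?_))))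
    · exact isSigma0_natLE (f1.comp (f1.comp f1)) (f2.comp (f1.comp f1)) (f2.comp f1)
    · exact isSigma0_natLE (f1.comp (f1.comp f1)) (f2.comp f1) f2
    · exact isSigma0_natLE (f1.comp (f1.comp f1)) (f2.comp (f1.comp f1)) f2
  · exact IsSigma0.pi_succ (IsSigma0.exists (k := 0)
      (p := fun (P : Presentation) a => Accepts P.1 a) (dom f1 f2))
  · refine IsPi0.forall (k := 1) (p := fun (P : Presentation) a => ∀ b, (Accepts P.1 a ∧
      Accepts P.1 b) → ∃ c, natLE P c a ∧ natLE P c b) (IsPi0.forall (k := 1)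
      (p := fun (x : Presentation × ℕ) b => (Accepts x.1.1 x.2 ∧ Accepts x.1.1 b) →
        ∃ c, natLE x.1 c x.2 ∧ natLE x.1 c b) (IsPi0.imp (IsSigma0.succ (IsSigma0.and ?_ ?_))
      (IsSigma0.pi_succ (IsSigma0.exists (k := 0) (p := fun (x : (Presentation × ℕ) × ℕ) c =>
        natLE x.1.1 c x.1.2 ∧ natLE x.1.1 c x.2) (IsSigma0.and ?_ ?_)))))
    · exact dom (f1.comp f1) (f2.comp f1)
    · exact dom (f1.comp f1) f2
    · exact isSigma0_natLE (f1.comp (f1.comp f1)) f2 (f2.comp (f1.comp f1))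
    · exact isSigma0_natLE (f1.comp (f1.comp f1)) f2 (f2.comp f1)
  · refine IsPi0.forall (k := 1) (p := fun (P : Presentation) a => ∀ b c, (natLE P b a ∧
      natLE P c a) → natLE P b c ∨ natLE P c b) (IsPi0.forall (k := 1)
      (p := fun (x : Presentation × ℕ) b => ∀ c, (natLE x.1 b x.2 ∧ natLE x.1 c x.2) →
        natLE x.1 b c ∨ natLE x.1 c b) (IsPi0.forall (k := 1)
      (p := fun (x : (Presentation × ℕ) × ℕ) c => (natLE x.1.1 x.2 x.1.2 ∧ natLE x.1.1 c x.1.2) →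
        natLE x.1.1 x.2 c ∨ natLE x.1.1 c x.2) (IsPi0.imp (IsSigma0.succ (IsSigma0.and ?_ ?_))
          (IsSigma0.pi_succ (IsSigma0.or ?_ ?_)))))
    · exact isSigma0_natLE (f1.comp (f1.comp f1)) (f2.comp f1) (f2.comp (f1.comp f1))
    · exact isSigma0_natLE (f1.comp (f1.comp f1)) f2 (f2.comp (f1.comp f1))
    · exact isSigma0_natLE (f1.comp (f1.comp f1)) (f2.comp f1) f2
    · exact isSigma0_natLE (f1.comp (f1.comp f1)) f2 (f2.comp f1)
  · refine IsPi0.forall (k := 1) (p := fun (P : Presentation) a => ∀ l : List ℕ, (l.Nodup ∧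
      l.length = n + 1) → ¬ ∀ b ∈ l, natLE P b a ∧ b ≠ a) (IsPi0.forall (k := 1)
      (p := fun (x : Presentation × ℕ) (l : List ℕ) => (l.Nodup ∧ l.length = n + 1) →
        ¬ ∀ b ∈ l, natLE x.1 b x.2 ∧ b ≠ x.2) (IsPi0.imp (IsSigma0.and ?_ ?_)
        (isPi0_not_iff.2 (IsSigma0.succ (IsSigma0.forall_mem
          (p := fun (x : (Presentation × ℕ) × List ℕ) b => natLE x.1.1 b x.1.2 ∧ b ≠ x.1.2)
          (IsSigma0.and ?_ ?_) f2)))))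
    · exact (computablePred_nodup f2).sigma _
    · exact (computablePred_eq (Computable.list_length.comp f2) (Computable.const _)).sigma _
    · exact isSigma0_natLE (f1.comp (f1.comp f1)) f2 (f2.comp (f1.comp f1))
    · exact (computablePred_eq f2 (f2.comp (f1.comp f1))).not.sigma _

theorem isSigma0_isMin {P : α → Presentation} {r : α → ℕ} (hP : Computable P) (hr : Computable r) :
    IsSigma0 2 fun a => IsMin (P a) (r a) := by
  refine IsSigma0.and (isSigma0_accepts (Computable.fst.comp hP) hr).succ (IsPi0.sigma_succ ?_)
  refine IsPi0.forall (k := 0) (p := fun a w => natLE (P a) w (r a) → w = r a) (IsPi0.imp ?_ ?_)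
  · exact isSigma0_natLE (hP.comp Computable.fst) Computable.snd (hr.comp Computable.fst)
  · exact (computablePred_eq Computable.snd (hr.comp Computable.fst)).pi _

theorem isPi0_isoProblem {n : ℕ} (hn : 1 ≤ n) : IsPi0 (2 * n) (IsoProblem n) := by
  obtain ⟨k, rfl⟩ : ∃ k, n = k + 1 := ⟨n - 1, by omega⟩
  have hT := isPi0_arithTree (k + 1)
  have hI : IsPi0 (2 * (k + 1)) fun p : Presentation × Presentation => ∀ r s : ℕ,
      (IsMin p.1 r ∧ IsMin p.2 s) → ArithIso (k + 1) ((p.1, r), (p.2, s)) := by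
    have c1 : Computable fun x : ((Presentation × Presentation) × ℕ) × ℕ => x.1.1.1 :=
      Computable.fst.comp (Computable.fst.comp Computable.fst)
    have c2 : Computable fun x : ((Presentation × Presentation) × ℕ) × ℕ => x.1.1.2 :=
      Computable.snd.comp (Computable.fst.comp Computable.fst)
    have cr : Computable fun x : ((Presentation × Presentation) × ℕ) × ℕ => x.1.2 :=
      Computable.snd.comp Computable.fst
    refine IsPi0.forall (k := 2 * k + 1) (p := fun (p : Presentation × Presentation) r => ∀ s : ℕ,
      (IsMin p.1 r ∧ IsMin p.2 s) → ArithIso (k + 1) ((p.1, r), (p.2, s)))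
      (IsPi0.forall (k := 2 * k + 1) (p := fun (x : (Presentation × Presentation) × ℕ) s =>
        (IsMin x.1.1 x.2 ∧ IsMin x.1.2 s) → ArithIso (k + 1) ((x.1.1, x.2), (x.1.2, s)))
        (IsPi0.imp (IsSigma0.mono (k := 2) (IsSigma0.and ?_ ?_) (by omega)) ?_))
    · exact isSigma0_isMin c1 cr
    · exact isSigma0_isMin c2 Computable.snd
    · exact (isPi0_arithIso (k + 1)).comp
        (Computable.pair (Computable.pair c1 cr) (Computable.pair c2 Computable.snd))
  refine IsPi0.of_iff (IsPi0.and ((hT.comp Computable.fst).mono (by omega))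
    (IsPi0.and ((hT.comp Computable.snd).mono (by omega)) hI)) fun p => ?_
  unfold IsoProblem
  simp only [← isTreeOfHeightLE_iff]
  -- The arithmetical description of isomorphism need only be correct for pairs already known to
  -- present trees.
  exact and_congr_right fun h1 => and_congr_right fun h2 => iso_iff_arithIso h1 h2

end Complexity

end RecTree

/-- The isomorphism problem for recursive trees of height at most `n` is `Π⁰_{2n}`-complete, and
hardness holds already for pairs that are presentations of recursive trees of height at
most `n`. -/
theorem theorem5p1 (n : ℕ) (hn : 1 ≤ n) :
    RecTree.IsPi0Complete (2 * n) (RecTree.IsoProblem n) ∧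
    ∀ B : ℕ → Prop, RecTree.IsPi0 (2 * n) B →
      ∃ f : ℕ → RecTree.Presentation × RecTree.Presentation, Computable f ∧
        (∀ x, (f x).1.IsTreeOfHeightLE n ∧ (f x).2.IsTreeOfHeightLE n) ∧
        ∀ x, B x ↔ (f x).1.Iso (f x).2 := by
  refine ⟨⟨RecTree.isPi0_isoProblem hn, fun B hB => ?_⟩,
    fun B hB => RecTree.exists_reduction hn hB⟩
  obtain ⟨f, hf, htree, hiso⟩ := RecTree.exists_reduction hn hB
  exact ⟨f, hf, fun x => (hiso x).trans
    ⟨fun h => ⟨(htree x).1, (htree x).2, h⟩, fun h => h.2.2⟩⟩
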